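/- **Model.** Transmitters form a homogeneous Poisson point process on the plane with density $\lambda_t>0$; independently of everything else each transmitter is active in a slot with probability $\rho_a\in[0,1]$ and has a main lobe of width $\theta$ with uniformly distributed axis. Centres of obstacles form an independent homogeneous Poisson process with density $\lambda_o>0$. A typical receiver at the origin has a main lobe of width $\theta\in(0,2\pi]$, which is divided into $k=\theta/\theta_c$ coherence sectors of angle $\theta_c>0$, $k$ a positive integer. Its intended transmitter (not a point of the process) is uniformly distributed in the part of the main lobe within the interference range $d_{\max}>0$ (so that the link length has density $2\ell/d_{\max}^2$), is active with probability $\rho_a$, and is independent of the two processes. A transmitter in the main lobe of the receiver at distance $d$ is in line of sight (LoS) if its coherence sector contains no obstacle at distance at most $d$ from the origin. A collision occurs if some other active transmitter has the receiver in its main lobe, is in the main lobe of the receiver, is at distance at most $d_{\max}$ and is in LoS. A packet succeeds if the intended transmitter sends, is in LoS, and there is no collision. **Schedulers.** Let a scheduler regulate the links in a measurable region of area $A\in(0,\infty)$, namely the typical link and one link for each point of the transmitter process in the region. Let $N$ be the number of the latter. Under TDMA each of the $N+1$ links owns one slot in every frame of $N+1$ slots, and it alone is active in it. Under slotted ALOHA,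 in every slot the active transmitters are those given by the activity variables above. The per-link throughput $r$ is the expected number of packets per slot delivered on the typical link. The area spectral efficiency (ASE) is the average network throughput divided by $A$, that is, $\frac1A\,\mathbb E\big[\sum_{i=0}^{N} r_i(N)\big]$, where $r_i(n)$ is the throughput of link $i$ among $n+1$ scheduled links, averaged over the surroundings of a typical receiver. **Claim.** Put $A_x=\theta_c x^2/2$ and $\lambda_I=\rho_a\lambda_t\theta/2\pi$, and let $$\rho_{c\mid\ell}=1-\Big(\tfrac{\lambda_o+\lambda_I e^{-(\lambda_o+\lambda_I)A_{d_{\max}}}}{\lambda_o+\lambda_I}\Big)^{\lceil\theta/\theta_c\rceil-1}\Big(e^{-\lambda_I A_\ell}-\tfrac{\lambda_I e^{\lambda_o A_\ell}}{\lambda_o+\lambda_I}\big(e^{-(\lambda_o+\lambda_I)A_\ell}-e^{-(\lambda_o+\lambda_I)A_{d_{\max}}}\big)\Big).$$ Then $$r_{\mathrm{TDMA}}=\Big(\frac{1-e^{-\lambda_t A}}{\lambda_t A}\Big)\Big(\frac{1-e^{-\lambda_o A_{d_{\max}}}}{\lambda_o A_{d_{\max}}}\Big),\qquad \mathrm{ASE}_{\mathrm{TDMA}}=\frac{1-e^{-\lambda_o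 A_{d_{\max}}}}{A\,\lambda_o A_{d_{\max}}},$$ $$\mathrm{ASE}_{\mathrm{S\text{-}ALOHA}}=\frac{1+A\lambda_t}{A}\int_0^{d_{\max}}\frac{2\rho_a}{d_{\max}^2}\,e^{-\lambda_o A_\ell}\,(1-\rho_{c\mid\ell})\,\ell\,d\ell .$$ -/

import Mathlib

open MeasureTheory ProbabilityTheory

namespace MmWave

/-! ### Poisson point processes -/

/-- The sigma-algebra on `Ω` generated by the numbers of points of the random set `Φ` in all
measurable sets. -/
@[reducible] noncomputable def countSigma {Ω E : Type*} [MeasurableSpace E] (Φ : Ω → Set E) : MeasurableSpace Ω :=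
  ⨆ B : {B : Set E // MeasurableSet B},
    MeasurableSpace.comap (fun ω => (Φ ω ∩ B.1).encard) inferInstance

/-- `Φ` is (the random set of points of) a Poisson point process with intensity measure `μ`: the
number of points in a measurable set `B` with `μ B < ∞` is a Poisson variable with mean `μ B`, and
the numbers of points in finitely many pairwise disjoint such sets are independent. Points are
recorded without multiplicity, which is no restriction for an intensity without atoms. -/
structure IsPoissonProcess {Ω E : Type*} [MeasurableSpace Ω] [MeasurableSpace E]
    (P : Measure Ω) (Φ : Ω → Set E) (μ : Measure E) : Prop where
  measurable_count : ∀ B : Set E, MeasurableSet B → Measurable fun ω => (Φ ω ∩ B).encard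
  map_count : ∀ B : Set E, MeasurableSet B → μ B < ⊤ →
    P.map (fun ω => (Φ ω ∩ B).encard) =
      (poissonMeasure (μ B).toNNReal).map (Nat.cast : ℕ → ℕ∞)
  indep_count : ∀ (n : ℕ) (B : Fin n → Set E), (∀ i, MeasurableSet (B i)) → (∀ i, μ (B i) < ⊤) →
    Pairwise (Function.onFun Disjoint B) → iIndepFun (fun i ω => (Φ ω ∩ B i).encard) P

/-! ### Parameters and geometry

The plane is `ℂ`, the typical receiver is at the origin and its main lobe is centred on the
positive real axis. -/

/-- Parameters of the network: densities of transmitters and obstacles per unit area, probability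
that a transmitter is active, operating beamwidth, coherence angle, interference range. -/
structure Params where
  lamT : ℝ
  lamO : ℝ
  rhoA : unitInterval
  theta : ℝ
  thetaC : ℝ
  dmax : ℝ

/-- Directions in the plane, as angles modulo `2π`. -/
abbrev Direction : Type := AddCircle (2 * Real.pi)

instance factTwoPiPos : Fact (0 < 2 * Real.pi) := ⟨Real.two_pi_pos⟩

/-- A transmitter: its position, whether it is active in the slot, and the direction of the axis
of its main lobe. -/
abbrev Transmitter : Type := ℂ × Bool × Direction

/-- The angular region seen through the main lobe of the typical receiver. -/
def mainLobe (p : Params) : Set ℂ :=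
  {z | Complex.arg z ∈ Set.Ioc (-(p.theta / 2)) (p.theta / 2)}

/-- The number of coherence sectors in the main lobe. -/
noncomputable def numSectors (p : Params) : ℕ := ⌈p.theta / p.thetaC⌉₊

/-- The coherence sectors of the main lobe, numbered `0, …, numSectors p - 1`. -/
def sector (p : Params) (j : ℕ) : Set ℂ :=
  {z | Complex.arg z ∈
    Set.Ioc (-(p.theta / 2) + j * p.thetaC) (-(p.theta / 2) + (j + 1) * p.thetaC)}

/-- A transmitter at `y` whose main lobe has axis `φ` has the origin inside its main lobe: `φ`
differs by at most `θ / 2` from the direction from `y` to the origin. -/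
def PointsToOrigin (p : Params) (y : ℂ) (φ : Direction) : Prop :=
  φ ∈ Metric.closedBall ((Complex.arg (-y) : ℝ) : Direction) (p.theta / 2)

/-! ### The network around a typical receiver in one slot -/

/-- What is around the typical receiver in a slot: the transmitters other than the intended one,
the obstacles, the position of the intended (typical) transmitter, and whether the latter is
active under slotted ALOHA. -/
structure Snapshot where
  tx : Set Transmitter
  obst : Set ℂ
  typPos : ℂ
  typActive : Bool

/-- The link from `z` to the origin is blocked (not in line of sight): inside the coherence sector
that contains `z` there is an obstacle which is not farther from the origin than `z`. -/
def Blocked (p : Params) (O : Set ℂ) (z : ℂ) : Prop :=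
  ∃ j < numSectors p, z ∈ sector p j ∧ ∃ o ∈ O, o ∈ sector p j ∧ ‖o‖ ≤ ‖z‖

/-- Collision at the typical receiver (protocol model) when `I` is the set of positions and beam
axes of the other transmitters that are active: one of them has the receiver inside its main lobe,
is inside the main lobe of the receiver and within the interference range, and has line of
sight. -/
def Collision (p : Params) (O : Set ℂ) (I : Set (ℂ × Direction)) : Prop :=
  ∃ q ∈ I, PointsToOrigin p q.1 q.2 ∧ q.1 ∈ mainLobe p ∧ ‖q.1‖ ≤ p.dmax ∧ ¬ Blocked p O q.1

/-- A packet gets through on the typical link: the intended transmitter sends, is in line of sight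
and there is no collision with the active transmitters `I`. -/
def Success (p : Params) (s : Snapshot) (sends : Prop) (I : Set (ℂ × Direction)) : Prop :=
  sends ∧ ¬ Blocked p s.obst s.typPos ∧ ¬ Collision p s.obst I

/-- The stochastic model. Transmitters form a Poisson process of density `lamT`, independently
marked by their activity (active with probability `rhoA`) and a uniformly distributed beam axis;
the obstacles form a Poisson process of density `lamO`; the typical transmitter is uniformly
distributed in the main lobe of the receiver up to distance `dmax` and is active with probability
`rhoA`; these four objects are independent. -/
structure IsNetwork {Ω : Type*} [MeasurableSpace Ω] (P : Measure Ω) (p : Params)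
    (S : Ω → Snapshot) : Prop where
  poisson_tx : IsPoissonProcess P (fun ω => (S ω).tx)
    ((ENNReal.ofReal p.lamT • (volume : Measure ℂ)).prod
      ((bernoulliMeasure true false p.rhoA).prod AddCircle.haarAddCircle))
  poisson_obst : IsPoissonProcess P (fun ω => (S ω).obst)
    (ENNReal.ofReal p.lamO • (volume : Measure ℂ))
  measurable_typPos : Measurable fun ω => (S ω).typPos
  law_typPos : P.map (fun ω => (S ω).typPos) =
    ProbabilityTheory.cond volume (mainLobe p ∩ Metric.closedBall 0 p.dmax)
  measurable_typActive : Measurable fun ω => (S ω).typActive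
  law_typActive : P.map (fun ω => (S ω).typActive) = bernoulliMeasure true false p.rhoA
  indep : iIndep ![countSigma (fun ω => (S ω).tx), countSigma (fun ω => (S ω).obst),
    MeasurableSpace.comap (fun ω => (S ω).typPos) inferInstance,
    MeasurableSpace.comap (fun ω => (S ω).typActive) inferInstance] P

/-- The number of transmitters, besides the typical one, in the region `R`. -/
noncomputable def numOthers (R : Set ℂ) (s : Snapshot) : ℕ :=
  (s.tx ∩ R ×ˢ Set.univ).encard.toNat

/-! ### Schedulers, throughput and area spectral efficiency -/

/-- Packets per slot that link number `i` out of `n + 1` links sharing the scheduled region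
delivers when its surroundings are given by a snapshot. Link number `0` is the typical link. -/
abbrev Throughput : Type := ℕ → ℕ → Snapshot → ℝ

open Classical in
/-- TDMA: a frame has one slot for each of the `n + 1` links; in slot `i` link `i` sends, and no
other transmitter is active. The value is the number of packets that link `i` delivers in a frame
divided by the length of the frame. -/
noncomputable def tdma (p : Params) : Throughput := fun n i s =>
  (∑ t ∈ Finset.range (n + 1), if Success p s (t = i) ∅ then (1 : ℝ) else 0) / (n + 1)

open Classical in
/-- Slotted ALOHA: in every slot each transmitter is active or not according to its own mark,
regardless of the number of links. -/
noncomputable def slottedAloha (p : Params) : Throughput := fun _ _ s =>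
  if Success p s (s.typActive = true) {q | (q.1, true, q.2) ∈ s.tx} then 1 else 0

/-- Average per-link throughput: expected throughput of the typical link, when it shares the
region `R` with the transmitters of the process that are in `R`. -/
noncomputable def perLinkThroughput {Ω : Type*} [MeasurableSpace Ω] (P : Measure Ω)
    (S : Ω → Snapshot) (R : Set ℂ) (T : Throughput) : ℝ :=
  ∫ ω, T (numOthers R (S ω)) 0 (S ω) ∂P

/-- Area spectral efficiency: the average network throughput, that is, the sum of the throughputs
of all links of the region `R` (the typical link and one for every other transmitter in `R`),
divided by the area of `R`. Every link of the homogeneous network counts with the throughput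
averaged over the surroundings of a typical receiver. -/
noncomputable def areaSpectralEfficiency {Ω : Type*} [MeasurableSpace Ω] (P : Measure Ω)
    (S : Ω → Snapshot) (R : Set ℂ) (T : Throughput) : ℝ :=
  (∫ ω, ∑ i ∈ Finset.range (numOthers R (S ω) + 1),
    (∫ ω', T (numOthers R (S ω)) i (S ω') ∂P) ∂P) / (volume R).toReal

/-! ### Quantities in the closed forms -/

/-- Area of a circle sector with radius `d` and angle `thetaC`. -/
noncomputable def sectorArea (p : Params) (d : ℝ) : ℝ := p.thetaC * d ^ 2 / 2

/-- Density of the active transmitters that have the typical receiver in their main lobe. -/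
noncomputable def lamI (p : Params) : ℝ := p.rhoA * p.lamT * p.theta / (2 * Real.pi)

/-- The closed form of the conditional collision probability, given a typical link of length
`l`. -/
noncomputable def condCollisionProb (p : Params) (l : ℝ) : ℝ :=
  1 - ((p.lamO + lamI p * Real.exp (-((p.lamO + lamI p) * sectorArea p p.dmax))) /
        (p.lamO + lamI p)) ^ (⌈p.theta / p.thetaC⌉₊ - 1) *
      (Real.exp (-(lamI p * sectorArea p l)) -
        lamI p * Real.exp (p.lamO * sectorArea p l) / (p.lamO + lamI p) *
          (Real.exp (-((p.lamO + lamI p) * sectorArea p l)) -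
            Real.exp (-((p.lamO + lamI p) * sectorArea p p.dmax))))

end MmWave

/-! Within a coherence sector, measure the distance of a point by the area of the circle sector
reaching up to it (`areaTo`). In this coordinate planar area on one sector becomes Lebesgue measure
on the half-line (`lintegral_sector_areaTo`), so the nearest obstacle of a sector, looked for only
up to `D = sectorArea p p.dmax`, is an exponential variable of rate `lamO` censored at `D`. The
nearest interferer behaves likewise with rate `lamI`, the density left after thinning by activity
and beam axis (`measure_iUnion_interfererDist_lt`). Independence over sectors follows from void
probabilities: joint lower bounds on the nearest points say that one union of disjoint regions is
empty, and its area is a sum (`IsPoissonProcess.measure_le_nearest`, `pi_censoredExp_eq`).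

The events of the model compare these variables. A link is in line of sight iff its area coordinate
lies strictly below that of the nearest obstacle in its sector (`not_blocked_iff`); there is no
collision iff in every sector the nearest obstacle is at most as far as the nearest interferer
(`not_collision_iff`). Given the link's coordinate `s`, the success probability is a product over
sectors: each other sector contributes the chance that an obstacle variable is at most an interferer
variable, and the link's own sector contributes the same chance with the obstacle also beyond `s`.
The product is `clearProb`; interferer rate `0` gives TDMA and rate `lamI` gives ALOHA.

The coordinate of the typical link is uniform on `(0, D]`, so it remains to average `clearProb` over
`s`; substituting `s = sectorArea p l` yields the integral over link lengths. Under TDMA the number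
`N` of other links enters through the mean of `1 / (N + 1)` and cancels from the ASE; under ALOHA
only the mean of `N + 1` matters. -/

namespace MmWave

open scoped ENNReal

/-! ### Nearest points of a Poisson process and void probabilities. -/

section Poisson

variable {Ω E ι : Type*}

/-- For each `i`, the smallest value that `f i` takes on the points of `Φ`. -/
noncomputable def nearest (f : ι → E → ℝ≥0∞) (Φ : Set E) (i : ι) : ℝ≥0∞ := ⨅ x ∈ Φ, f i x

lemma le_nearest_iff {f : ι → E → ℝ≥0∞} {Φ : Set E} {i : ι} {u : ℝ≥0∞} :
    u ≤ nearest f Φ i ↔ ∀ x ∈ Φ, u ≤ f i x := by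
  simp [nearest]

lemma nearest_lt_iff {f : ι → E → ℝ≥0∞} {Φ : Set E} {i : ι} {u : ℝ≥0∞} :
    nearest f Φ i < u ↔ ∃ x ∈ Φ, f i x < u := by
  simp [nearest, iInf_lt_iff]

/-- A strict bound survives the infimum because only finitely many points have a finite value, so a
finite infimum is attained. -/
lemma lt_nearest_iff {f : ι → E → ℝ≥0∞} {Φ : Set E} {i : ι} {u : ℝ≥0∞}
    (hfin : (Φ ∩ {x | f i x < ⊤}).Finite) (hu : u ≠ ⊤) :
    u < nearest f Φ i ↔ ∀ x ∈ Φ, u < f i x := by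
  refine ⟨fun h x hx => h.trans_le (le_nearest_iff.1 le_rfl x hx), fun h => ?_⟩
  rcases (Φ ∩ {x | f i x < ⊤}).eq_empty_or_nonempty with he | hne
  · refine lt_of_lt_of_le hu.lt_top (le_nearest_iff.2 fun x hx => ?_)
    by_contra hlt
    exact (Set.eq_empty_iff_forall_notMem.1 he x) ⟨hx, not_le.1 hlt⟩
  · obtain ⟨a, ha, hmin⟩ := Set.exists_min_image _ (f i) hfin hne
    refine (h a ha.1).trans_le (le_nearest_iff.2 fun x hx => ?_)
    by_cases hx' : f i x < ⊤
    · exact hmin x ⟨hx, hx'⟩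
    · exact le_top.trans (not_lt.1 hx')

variable [MeasurableSpace E]

lemma measurable_encard_countSigma (Φ : Ω → Set E) {B : Set E} (hB : MeasurableSet B) :
    Measurable[countSigma Φ] fun ω => (Φ ω ∩ B).encard :=
  Measurable.mono (comap_measurable _)
    (le_iSup (fun B : {B : Set E // MeasurableSet B} =>
      MeasurableSpace.comap (fun ω => (Φ ω ∩ B.1).encard) inferInstance) ⟨B, hB⟩) le_rfl

/-- The nearest point is at least `u` away exactly when the count in `{f i < u}` is zero. -/
lemma measurable_nearest (Φ : Ω → Set E) {f : ι → E → ℝ≥0∞} (hf : ∀ i, Measurable (f i)) :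
    Measurable[countSigma Φ] fun ω => nearest f (Φ ω) := by
  let : MeasurableSpace Ω := countSigma Φ
  refine measurable_pi_lambda _ fun i => measurable_of_Ici fun u => ?_
  have : (fun ω => nearest f (Φ ω) i) ⁻¹' Set.Ici u =
      (fun ω => (Φ ω ∩ {x | f i x < u}).encard) ⁻¹' {0} := by
    ext ω
    simp [le_nearest_iff, Set.eq_empty_iff_forall_notMem]
  rw [this]
  exact measurable_encard_countSigma Φ (measurableSet_lt (hf i) measurable_const)
    (measurableSet_singleton _)

variable [MeasurableSpace Ω] {P : Measure Ω} {Φ : Ω → Set E} {μ : Measure E}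

lemma IsPoissonProcess.countSigma_le (h : IsPoissonProcess P Φ μ) :
    countSigma Φ ≤ ‹MeasurableSpace Ω› :=
  iSup_le fun B => (h.measurable_count B.1 B.2).comap_le

/-- The value `0` of `toNat` at `⊤` does no harm, since the law of the count is carried by the
natural numbers. -/
lemma IsPoissonProcess.map_toNat_count (h : IsPoissonProcess P Φ μ) {B : Set E}
    (hB : MeasurableSet B) (hμB : μ B < ⊤) :
    P.map (fun ω => (Φ ω ∩ B).encard.toNat) = poissonMeasure (μ B).toNNReal := by
  have h1 : P.map (fun ω => (Φ ω ∩ B).encard.toNat) =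
      (P.map (fun ω => (Φ ω ∩ B).encard)).map ENat.toNat :=
    (Measure.map_map (Measurable.of_discrete) (h.measurable_count B hB)).symm
  rw [h1, h.map_count B hB hμB, Measure.map_map .of_discrete .of_discrete]
  convert Measure.map_id
  ext n
  simp

lemma IsPoissonProcess.measure_void (h : IsPoissonProcess P Φ μ) {B : Set E}
    (hB : MeasurableSet B) (hμB : μ B < ⊤) :
    P {ω | Φ ω ∩ B = ∅} = ENNReal.ofReal (Real.exp (-(μ B).toReal)) := by
  have h1 : {ω | Φ ω ∩ B = ∅} = (fun ω => (Φ ω ∩ B).encard) ⁻¹' {0} := by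
    ext ω; simp
  have h2 : (Nat.cast : ℕ → ℕ∞) ⁻¹' {0} = {0} := by
    ext n; simp
  rw [h1, ← Measure.map_apply (h.measurable_count B hB) (measurableSet_singleton _),
    h.map_count B hB hμB, Measure.map_apply .of_discrete (measurableSet_singleton _), h2,
    poissonMeasure_singleton]
  simp [ENNReal.toReal]

lemma IsPoissonProcess.ae_finite (h : IsPoissonProcess P Φ μ) {B : Set E}
    (hB : MeasurableSet B) (hμB : μ B < ⊤) : ∀ᵐ ω ∂P, (Φ ω ∩ B).Finite := by
  have h1 : ∀ᵐ n ∂(P.map (fun ω => (Φ ω ∩ B).encard)), n ≠ ⊤ := by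
    rw [h.map_count B hB hμB, ae_map_iff Measurable.of_discrete.aemeasurable .of_discrete]
    exact .of_forall fun n => by simp
  filter_upwards [ae_of_ae_map (h.measurable_count B hB).aemeasurable h1] with ω hω
  exact Set.encard_ne_top_iff.1 hω

/-- All the bounds hold together iff the union of the regions is empty, so a single void probability
gives the joint tail. -/
lemma IsPoissonProcess.measure_le_nearest [Countable ι] (h : IsPoissonProcess P Φ μ)
    {f : ι → E → ℝ≥0∞} (hf : ∀ i, Measurable (f i)) (u : ι → ℝ≥0∞)
    (hμ : μ (⋃ i, {x | f i x < u i}) < ⊤) :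
    P {ω | ∀ i, u i ≤ nearest f (Φ ω) i} =
      ENNReal.ofReal (Real.exp (-(μ (⋃ i, {x | f i x < u i})).toReal)) := by
  rw [← h.measure_void (.iUnion fun i => measurableSet_lt (hf i) measurable_const) hμ]
  congr 1
  ext ω
  simp only [le_nearest_iff, Set.mem_ofPred_eq, Set.eq_empty_iff_forall_notMem, Set.mem_inter_iff,
    Set.mem_iUnion, not_and, not_exists, not_lt]
  exact ⟨fun h x hx i => h i x hx, fun h i x hx => h x hx i⟩

end Poisson

/-! ### Poisson means of `1 / (n + 1)` and `n + 1`. -/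

lemma integral_poissonMeasure_inv_add_one (r : NNReal) (hr : r ≠ 0) :
    ∫ n, ((n : ℝ) + 1)⁻¹ ∂(poissonMeasure r) = (1 - Real.exp (-r)) / r := by
  have hr' : (r : ℝ) ≠ 0 := by exact_mod_cast hr
  rw [integral_poissonMeasure]
  have h := (NormedSpace.expSeries_div_hasSum_exp (r : ℝ))
  -- Since `(n + 1) * n! = (n + 1)!`, the series is the exponential series without its zeroth term.
  rw [← Real.exp_eq_exp_ℝ, ← hasSum_nat_add_iff' 1] at h
  have h2 := (h.mul_left (Real.exp (-r) / r)).tsum_eq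
  convert h2 using 1
  · congr with n
    simp only [smul_eq_mul, Nat.factorial_succ, pow_succ]
    push_cast
    field_simp
  · simp [mul_sub, div_mul_eq_mul_div, ← Real.exp_add]
    field_simp

lemma hasSum_poissonMeasure_add_one (r : NNReal) :
    HasSum (fun n : ℕ => Real.exp (-r) * r ^ n / n.factorial * ((n : ℝ) + 1)) (1 + r) := by
  have h1 : HasSum (fun n : ℕ => Real.exp (-r) * r ^ n / n.factorial) 1 :=
    hasSum_one_poissonMeasure r
  have h2 : HasSum (fun n : ℕ => Real.exp (-r) * r ^ n / n.factorial * (n : ℝ)) r := by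
    rw [← hasSum_nat_add_iff' 1]
    have e1 : (fun n : ℕ => Real.exp (-r) * r ^ (n + 1) / (n + 1).factorial * ((n + 1 : ℕ) : ℝ)) =
        fun n : ℕ => (r : ℝ) * (Real.exp (-r) * r ^ n / n.factorial) := by
      ext n
      rw [Nat.factorial_succ]
      push_cast
      field_simp
      ring
    have e2 : (r : ℝ) - ∑ n ∈ Finset.range 1, Real.exp (-r) * r ^ n / n.factorial * (n : ℝ) =
        r * 1 := by simp
    rw [e1, e2]
    exact h1.mul_left _
  have e : (fun n : ℕ => Real.exp (-r) * r ^ n / n.factorial * ((n : ℝ) + 1)) = fun n : ℕ =>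
      Real.exp (-r) * r ^ n / n.factorial + Real.exp (-r) * r ^ n / n.factorial * (n : ℝ) := by
    ext n; ring
  rw [e]
  exact h1.add h2

lemma integral_poissonMeasure_add_one (r : NNReal) :
    ∫ n, ((n : ℝ) + 1) ∂(poissonMeasure r) = 1 + r := by
  rw [integral_poissonMeasure]
  exact (hasSum_poissonMeasure_add_one r).tsum_eq

/-! ### The area coordinate on wedges. -/

/-- Area of the circle sector of angle `c` whose radius is the norm of `z`. -/
noncomputable def areaTo (c : ℝ) (z : ℂ) : ℝ := c * ‖z‖ ^ 2 / 2

lemma measurable_areaTo (c : ℝ) : Measurable (areaTo c) := by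
  unfold areaTo; fun_prop

lemma areaTo_nonneg {c : ℝ} (hc : 0 ≤ c) (z : ℂ) : 0 ≤ areaTo c z := by
  unfold areaTo; positivity

lemma areaTo_le_iff {c : ℝ} (hc : 0 < c) {z w : ℂ} : areaTo c z ≤ areaTo c w ↔ ‖z‖ ≤ ‖w‖ := by
  unfold areaTo
  rw [div_le_div_iff_of_pos_right two_pos, mul_le_mul_iff_right₀ hc,
    sq_le_sq₀ (norm_nonneg _) (norm_nonneg _)]

/-- The set of points whose argument is in `(α, β]`. -/
def wedge (α β : ℝ) : Set ℂ := {z | Complex.arg z ∈ Set.Ioc α β}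

lemma measurableSet_wedge (α β : ℝ) : MeasurableSet (wedge α β) :=
  Complex.measurable_arg measurableSet_Ioc

lemma lintegral_wedge_norm {α β : ℝ} (hα : -Real.pi ≤ α) (hβ : β ≤ Real.pi)
    {F : ℝ → ℝ≥0∞} (hF : Measurable F) :
    ∫⁻ z in wedge α β, F ‖z‖ =
      ENNReal.ofReal (β - α) * ∫⁻ r in Set.Ioi (0 : ℝ), ENNReal.ofReal r * F r := by
  rw [← lintegral_indicator (measurableSet_wedge α β), ← Complex.lintegral_comp_polarCoord_symm]
  have h1 : ∀ q ∈ polarCoord.target, ENNReal.ofReal q.1 •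
      (wedge α β).indicator (fun z => F ‖z‖) (Complex.polarCoord.symm q) =
      (ENNReal.ofReal q.1 * F q.1) * (Set.Ioc α β).indicator 1 q.2 := by
    rintro ⟨r, t⟩ ⟨hr, ht⟩
    simp only [Set.mem_Ioi] at hr
    have ha : Complex.arg (Complex.polarCoord.symm (r, t)) = t := by
      rw [Complex.polarCoord_symm_apply]
      simpa using Complex.arg_mul_cos_add_sin_mul_I hr ⟨ht.1, ht.2.le⟩
    have hn : ‖Complex.polarCoord.symm (r, t)‖ = r := by
      rw [Complex.norm_polarCoord_symm, abs_of_pos hr]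
    by_cases hm : t ∈ Set.Ioc α β
    · rw [Set.indicator_of_mem (by rw [wedge, Set.mem_ofPred_eq, ha]; exact hm), hn, Set.indicator_of_mem hm]
      simp
    · rw [Set.indicator_of_notMem (by rw [wedge, Set.mem_ofPred_eq, ha]; exact hm), Set.indicator_of_notMem hm]
      simp
  rw [setLIntegral_congr_fun polarCoord.open_target.measurableSet h1, polarCoord_target,
    Measure.volume_eq_prod, ← Measure.prod_restrict,
    lintegral_prod_mul (f := fun r : ℝ => ENNReal.ofReal r * F r)
      (g := (Set.Ioc α β).indicator 1)
      (by fun_prop) ((measurable_one.indicator measurableSet_Ioc).aemeasurable),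
    mul_comm, lintegral_indicator_one measurableSet_Ioc, Measure.restrict_apply measurableSet_Ioc]
  congr 1
  -- The polar chart omits the angle `π`, which the wedge contains when `β = π` and `α < π`; this is
  -- a null set.
  have h2 : (Set.Ioc α β ∩ Set.Ioo (-Real.pi) Real.pi : Set ℝ) =ᵐ[volume]
      (Set.Ioc α β ∩ Set.Ioc (-Real.pi) Real.pi : Set ℝ) :=
    Filter.EventuallyEq.inter (ae_eq_refl _) Ioo_ae_eq_Ioc
  rw [measure_congr h2, Set.inter_eq_left.2, Real.volume_Ioc]
  exact Set.Ioc_subset_Ioc hα hβ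

lemma image_sq_Ioi {c : ℝ} (hc : 0 < c) :
    (fun r : ℝ => c * r ^ 2 / 2) '' Set.Ioi 0 = Set.Ioi 0 := by
  ext s
  constructor
  · rintro ⟨r, hr, rfl⟩
    simp only [Set.mem_Ioi] at hr ⊢
    positivity
  · intro hs
    simp only [Set.mem_Ioi] at hs
    refine ⟨Real.sqrt (2 * s / c), Real.sqrt_pos.2 (by positivity), ?_⟩
    simp only
    rw [Real.sq_sqrt (by positivity)]
    field_simp

/-- Substitution `s = c * r ^ 2 / 2`, for which `ds = c * r dr`. -/
lemma lintegral_radius_eq_area {c : ℝ} (hc : 0 < c) (F : ℝ → ℝ≥0∞) :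
    ENNReal.ofReal c * ∫⁻ r in Set.Ioi (0 : ℝ), ENNReal.ofReal r * F (c * r ^ 2 / 2) =
      ∫⁻ s in Set.Ioi (0 : ℝ), F s := by
  have h := lintegral_image_eq_lintegral_abs_deriv_mul (f := fun r : ℝ => c * r ^ 2 / 2)
    (f' := fun r => c * r) (s := Set.Ioi 0) measurableSet_Ioi
    (fun r _ => by
      have := (((hasDerivAt_pow 2 r).const_mul c).div_const 2).hasDerivWithinAt (s := Set.Ioi 0)
      refine this.congr_deriv ?_
      simp; ring)
    (fun r hr r' hr' hrr => by
      simp only [Set.mem_Ioi] at hr hr'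
      have : r ^ 2 = r' ^ 2 := mul_left_cancel₀ hc.ne' (by simpa using hrr)
      exact (sq_eq_sq₀ hr.le hr'.le).1 this) F
  rw [image_sq_Ioi hc] at h
  rw [h, ← lintegral_const_mul' _ _ ENNReal.ofReal_ne_top]
  refine setLIntegral_congr_fun measurableSet_Ioi fun r hr => ?_
  simp only [Set.mem_Ioi] at hr
  rw [abs_of_pos (by positivity), ENNReal.ofReal_mul hc.le, mul_assoc]

lemma lintegral_wedge_areaTo {c α β : ℝ} (hc : 0 < c) (hα : -Real.pi ≤ α) (hβ : β ≤ Real.pi)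
    {F : ℝ → ℝ≥0∞} (hF : Measurable F) :
    ENNReal.ofReal c * ∫⁻ z in wedge α β, F (areaTo c z) =
      ENNReal.ofReal (β - α) * ∫⁻ s in Set.Ioi (0 : ℝ), F s := by
  have h := lintegral_wedge_norm hα hβ (F := fun r => F (c * r ^ 2 / 2)) (by fun_prop)
  simp only [areaTo, h]
  rw [mul_left_comm, lintegral_radius_eq_area hc]

lemma lintegral_sector_areaTo {c α : ℝ} (hc : 0 < c) (hα : -Real.pi ≤ α) (hβ : α + c ≤ Real.pi)
    {F : ℝ → ℝ≥0∞} (hF : Measurable F) :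
    ∫⁻ z in wedge α (α + c), F (areaTo c z) = ∫⁻ s in Set.Ioi (0 : ℝ), F s := by
  have h := lintegral_wedge_areaTo hc hα hβ hF
  rw [add_sub_cancel_left] at h
  exact (ENNReal.mul_right_inj (by simpa using hc) ENNReal.ofReal_ne_top).1 h

/-! ### Censored exponential laws. -/

/-- Probability that an exponential variable of rate `a`, replaced by `∞` above `D`, is at
least `u`. -/
noncomputable def censoredTail (a D : ℝ) (u : ℝ≥0∞) : ℝ≥0∞ :=
  ENNReal.ofReal (Real.exp (-(a * (min u (ENNReal.ofReal D)).toReal)))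

lemma measurable_censoredTail (a D : ℝ) : Measurable (censoredTail a D) := by
  unfold censoredTail; fun_prop

/-- The law of an exponential variable of rate `a` that is replaced by `∞` above `D`. -/
noncomputable def censoredExp (a D : ℝ) : Measure ℝ≥0∞ :=
  ((volume.restrict (Set.Ioc 0 D)).withDensity
    (fun s => ENNReal.ofReal (a * Real.exp (-(a * s))))).map ENNReal.ofReal +
  ENNReal.ofReal (Real.exp (-(a * D))) • Measure.dirac ⊤

lemma lintegral_censoredExp (a D : ℝ) {F : ℝ≥0∞ → ℝ≥0∞} (hF : Measurable F) :
    ∫⁻ u, F u ∂(censoredExp a D) =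
      (∫⁻ s in Set.Ioc 0 D, ENNReal.ofReal (a * Real.exp (-(a * s))) * F (ENNReal.ofReal s)) +
        ENNReal.ofReal (Real.exp (-(a * D))) * F ⊤ := by
  rw [censoredExp, lintegral_add_measure, lintegral_smul_measure, lintegral_dirac' _ hF,
    lintegral_map hF ENNReal.measurable_ofReal,
    lintegral_withDensity_eq_lintegral_mul _ (by fun_prop) (by fun_prop)]
  rfl

lemma lintegral_Ioc_exp {a : ℝ} (ha : 0 < a) {s t : ℝ} (hst : s ≤ t) (b : ℝ) (hb : 0 ≤ b) :
    ∫⁻ x in Set.Ioc s t, ENNReal.ofReal (b * Real.exp (-(a * x))) =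
      ENNReal.ofReal (b / a * (Real.exp (-(a * s)) - Real.exp (-(a * t)))) := by
  rw [← ofReal_integral_eq_lintegral_ofReal, ← intervalIntegral.integral_of_le hst]
  · congr 1
    rw [intervalIntegral.integral_eq_sub_of_hasDerivAt
      (f := fun x => -(b / a) * Real.exp (-(a * x)))]
    · ring
    · intro x _
      have h := (((hasDerivAt_id x).const_mul a).neg.exp).const_mul (-(b / a))
      refine h.congr_deriv ?_
      simp
      field_simp
    · exact Continuous.intervalIntegrable (by fun_prop) _ _
  · exact (Continuous.integrableOn_Icc (by fun_prop)).mono_set Set.Ioc_subset_Icc_self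
  · exact .of_forall fun x => by positivity

/-- This is the chance that `t < U ≤ V` for independent variables of rates `a` and `b`, both
censored at `D`. The last summand is the case `U = V = ⊤`. With `b = 0` the integrand is `1` and the
formula gives tails of `censoredExp`. -/
lemma lintegral_censoredExp_Ioi {a D : ℝ} (ha : 0 < a) {b : ℝ} (hb : 0 ≤ b) {t : ℝ}
    (ht : 0 ≤ t) (htD : t ≤ D) :
    ∫⁻ u in Set.Ioi (ENNReal.ofReal t), censoredTail b D u ∂(censoredExp a D) =
      ENNReal.ofReal (a / (a + b) * (Real.exp (-((a + b) * t)) - Real.exp (-((a + b) * D))) +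
        Real.exp (-((a + b) * D))) := by
  have hD : 0 ≤ D := ht.trans htD
  rw [← lintegral_indicator measurableSet_Ioi, lintegral_censoredExp _ _
    ((measurable_censoredTail b D).indicator measurableSet_Ioi)]
  have h1 : ∀ s ∈ Set.Ioc 0 D, ENNReal.ofReal (a * Real.exp (-(a * s))) *
      (Set.Ioi (ENNReal.ofReal t)).indicator (censoredTail b D) (ENNReal.ofReal s) =
      (Set.Ioc t D).indicator (fun s => ENNReal.ofReal (a * Real.exp (-((a + b) * s)))) s := by
    intro s hs
    by_cases h : t < s
    · rw [Set.indicator_of_mem (by simpa [ENNReal.ofReal_lt_ofReal_iff hs.1] using h),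
        Set.indicator_of_mem (Set.mem_Ioc.2 ⟨h, hs.2⟩), censoredTail,
        min_eq_left (ENNReal.ofReal_le_ofReal hs.2), ENNReal.toReal_ofReal hs.1.le,
        ← ENNReal.ofReal_mul (by positivity), mul_assoc, ← Real.exp_add]
      ring_nf
    · rw [Set.indicator_of_notMem (by simpa [ENNReal.ofReal_lt_ofReal_iff hs.1] using h),
        Set.indicator_of_notMem (fun h' => h h'.1), mul_zero]
  rw [setLIntegral_congr_fun measurableSet_Ioc h1, setLIntegral_indicator measurableSet_Ioc,
    Set.inter_eq_left.2 (Set.Ioc_subset_Ioc_left ht),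
    lintegral_Ioc_exp (by positivity) htD _ ha.le, Set.indicator_of_mem (by simp), censoredTail,
    min_eq_right le_top, ENNReal.toReal_ofReal hD, ← ENNReal.ofReal_mul (by positivity),
    ← Real.exp_add, ENNReal.ofReal_add _ (by positivity)]
  · ring_nf
  · refine mul_nonneg (by positivity) (sub_nonneg.2 (Real.exp_le_exp.2 ?_))
    nlinarith

lemma lintegral_censoredExp_univ {a D : ℝ} (ha : 0 < a) {b : ℝ} (hb : 0 ≤ b) (hD : 0 ≤ D) :
    ∫⁻ u, censoredTail b D u ∂(censoredExp a D) =
      ENNReal.ofReal ((a + b * Real.exp (-((a + b) * D))) / (a + b)) := by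
  -- The complement is `{0}`, a null set, so the case `t = 0` of the previous formula covers the
  -- whole space.
  have h0 : censoredExp a D (Set.Ioi (ENNReal.ofReal 0))ᶜ = 0 := by
    rw [← lintegral_indicator_one measurableSet_Ioi.compl, lintegral_censoredExp _ _
      (measurable_one.indicator measurableSet_Ioi.compl)]
    simp only [Set.compl_Ioi, ENNReal.ofReal_zero]
    rw [setLIntegral_congr_fun (g := 0) measurableSet_Ioc fun s hs => by simp [hs.1]]
    simp
  rw [← setLIntegral_univ, ← setLIntegral_congr (s := Set.Ioi (ENNReal.ofReal 0))
    (by rw [ae_eq_univ]; exact h0), lintegral_censoredExp_Ioi ha hb le_rfl hD]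
  congr 1
  have : a + b ≠ 0 := by positivity
  field_simp
  simp
  ring

lemma censoredTail_zero (D : ℝ) : censoredTail 0 D = 1 := by
  ext u; simp [censoredTail]

lemma isProbabilityMeasure_censoredExp {a D : ℝ} (ha : 0 < a) (hD : 0 ≤ D) :
    IsProbabilityMeasure (censoredExp a D) := by
  refine ⟨?_⟩
  have h := lintegral_censoredExp_univ ha le_rfl hD (b := 0)
  simpa [censoredTail_zero, ha.ne'] using h

lemma censoredExp_Ioi {a D : ℝ} (ha : 0 < a) {t : ℝ} (ht : 0 ≤ t) (htD : t ≤ D) :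
    censoredExp a D (Set.Ioi (ENNReal.ofReal t)) = ENNReal.ofReal (Real.exp (-(a * t))) := by
  have h := lintegral_censoredExp_Ioi ha le_rfl ht htD (b := 0)
  simpa [censoredTail_zero, ha.ne'] using h

lemma censoredExp_Ici {a D : ℝ} (ha : 0 < a) (hD : 0 ≤ D) (u : ℝ≥0∞) :
    censoredExp a D (Set.Ici u) = censoredTail a D u := by
  rw [censoredTail]
  rcases le_total u (ENNReal.ofReal D) with h | h
  · rw [min_eq_left h]
    obtain ⟨t, ht, rfl⟩ : ∃ t : ℝ, 0 ≤ t ∧ u = ENNReal.ofReal t :=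
      ⟨u.toReal, ENNReal.toReal_nonneg,
        (ENNReal.ofReal_toReal (ne_top_of_le_ne_top ENNReal.ofReal_ne_top h)).symm⟩
    have htD : t ≤ D := (ENNReal.ofReal_le_ofReal_iff hD).1 h
    have h0 : censoredExp a D {ENNReal.ofReal t} = 0 := by
      rw [← lintegral_indicator_one (measurableSet_singleton _), lintegral_censoredExp _ _
        (measurable_one.indicator (measurableSet_singleton _))]
      have hz : ∫⁻ s in Set.Ioc 0 D, ENNReal.ofReal (a * Real.exp (-(a * s))) *
          ({ENNReal.ofReal t} : Set ℝ≥0∞).indicator 1 (ENNReal.ofReal s) = 0 := by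
        rw [lintegral_congr_ae (g := 0)]
        · simp
        filter_upwards [ae_restrict_mem measurableSet_Ioc,
          compl_mem_ae_iff.2 (measure_singleton t)] with s hs hst
        have hne : ENNReal.ofReal s ≠ ENNReal.ofReal t := fun h' =>
          hst ((ENNReal.ofReal_eq_ofReal_iff hs.1.le ht).1 h')
        simp [hne]
      rw [hz]
      simp
    rw [← Set.Ioi_insert, Set.insert_eq, measure_union (by simp) measurableSet_Ioi, h0, zero_add,
      censoredExp_Ioi ha ht htD, ENNReal.toReal_ofReal ht]
  · rw [min_eq_right h, ENNReal.toReal_ofReal hD, ← lintegral_indicator_one measurableSet_Ici,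
      lintegral_censoredExp _ _ (measurable_one.indicator measurableSet_Ici)]
    have hz : ∫⁻ s in Set.Ioc 0 D, ENNReal.ofReal (a * Real.exp (-(a * s))) *
          (Set.Ici u).indicator 1 (ENNReal.ofReal s) = 0 := by
      -- The endpoint is dropped because for `u = ENNReal.ofReal D` the indicator does not vanish at
      -- `s = D`.
      rw [← setLIntegral_congr Ioo_ae_eq_Ioc,
        setLIntegral_congr_fun (g := 0) measurableSet_Ioo fun s hs => ?_]
      · simp
      have hlt : ENNReal.ofReal s < u :=
        ((ENNReal.ofReal_lt_ofReal_iff (hs.1.trans hs.2)).2 hs.2).trans_le h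
      simp [hlt]
    rw [hz]
    simp

/-! ### Geometry of the sectors and intensity of the interferers. -/

section Sectors

variable {p : Params}

lemma sector_eq_wedge (p : Params) (j : ℕ) : sector p j =
    wedge (-(p.theta / 2) + j * p.thetaC) (-(p.theta / 2) + j * p.thetaC + p.thetaC) := by
  rw [sector, wedge]
  ring_nf

lemma measurableSet_sector (p : Params) (j : ℕ) : MeasurableSet (sector p j) := by
  rw [sector_eq_wedge]
  exact measurableSet_wedge _ _

lemma measurableSet_mainLobe (p : Params) : MeasurableSet (mainLobe p) :=
  measurableSet_wedge _ _

lemma sector_index_unique (hc : 0 < p.thetaC) {i j : ℕ} {z : ℂ} (hi : z ∈ sector p i)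
    (hj : z ∈ sector p j) : i = j := by
  simp only [sector, Set.mem_ofPred_eq, Set.mem_Ioc] at hi hj
  have h1 : (i : ℝ) * p.thetaC < (j + 1) * p.thetaC := by linarith
  have h2 : (j : ℝ) * p.thetaC < (i + 1) * p.thetaC := by linarith
  have h3 := lt_of_mul_lt_mul_right h1 hc.le
  have h4 := lt_of_mul_lt_mul_right h2 hc.le
  norm_cast at h3 h4
  omega

lemma theta_eq_numSectors (hc : 0 < p.thetaC) (hint : ∃ k : ℕ, p.theta = k * p.thetaC) :
    p.theta = numSectors p * p.thetaC := by
  obtain ⟨k, hk⟩ := hint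
  have : numSectors p = k := by
    rw [numSectors, hk, mul_div_cancel_right₀ _ hc.ne', Nat.ceil_natCast]
  rw [this, hk]

lemma mem_mainLobe_iff (hc : 0 < p.thetaC) (hk : p.theta = numSectors p * p.thetaC) {z : ℂ} :
    z ∈ mainLobe p ↔ ∃ j : Fin (numSectors p), z ∈ sector p j := by
  constructor
  · intro hz
    simp only [mainLobe, Set.mem_ofPred_eq, Set.mem_Ioc] at hz
    -- `x` is the angle above the lower edge of the lobe in units of `thetaC`. Sectors are open
    -- below and closed above, so the index is `⌈x⌉₊ - 1`.
    set x := (Complex.arg z + p.theta / 2) / p.thetaC with hx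
    have hxm : x * p.thetaC = Complex.arg z + p.theta / 2 := div_mul_cancel₀ _ hc.ne'
    have hx0 : 0 < x := div_pos (by linarith) hc
    have hc1 : 0 < ⌈x⌉₊ := Nat.ceil_pos.2 hx0
    have hle : ⌈x⌉₊ ≤ numSectors p := by
      refine Nat.ceil_le.2 (le_of_mul_le_mul_right ?_ hc)
      linarith
    have hcast : ((⌈x⌉₊ - 1 : ℕ) : ℝ) = ⌈x⌉₊ - 1 := by
      rw [Nat.cast_sub hc1, Nat.cast_one]
    refine ⟨⟨⌈x⌉₊ - 1, by omega⟩, ?_⟩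
    simp only [sector, Set.mem_ofPred_eq, Set.mem_Ioc, hcast]
    have h1 := mul_lt_mul_of_pos_right (Nat.ceil_lt_add_one hx0.le) hc
    have h2 := mul_le_mul_of_nonneg_right (Nat.le_ceil x) hc.le
    constructor
    · linarith
    · linarith
  · rintro ⟨j, hz⟩
    simp only [sector, mainLobe, Set.mem_ofPred_eq, Set.mem_Ioc] at hz ⊢
    have h1 : ((j : ℕ) : ℝ) + 1 ≤ numSectors p := by exact_mod_cast j.2
    have h2 := mul_le_mul_of_nonneg_right h1 hc.le
    have h3 : 0 ≤ ((j : ℕ) : ℝ) * p.thetaC := by positivity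
    constructor
    · linarith
    · linarith

lemma sector_bounds (hc : 0 < p.thetaC) (hk : p.theta = numSectors p * p.thetaC)
    (hle : p.theta ≤ 2 * Real.pi) (j : Fin (numSectors p)) :
    -Real.pi ≤ -(p.theta / 2) + (j : ℕ) * p.thetaC ∧
      -(p.theta / 2) + (j : ℕ) * p.thetaC + p.thetaC ≤ Real.pi := by
  have h1 : ((j : ℕ) : ℝ) + 1 ≤ numSectors p := by exact_mod_cast j.2
  have h2 := mul_le_mul_of_nonneg_right h1 hc.le
  have h3 : 0 ≤ ((j : ℕ) : ℝ) * p.thetaC := by positivity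
  constructor <;> linarith

lemma sectorArea_nonneg (hc : 0 < p.thetaC) (d : ℝ) : 0 ≤ sectorArea p d := by
  unfold sectorArea; positivity

lemma areaTo_le_sectorArea_iff (hc : 0 < p.thetaC) (hd : 0 < p.dmax) {z : ℂ} :
    areaTo p.thetaC z ≤ sectorArea p p.dmax ↔ ‖z‖ ≤ p.dmax := by
  unfold areaTo sectorArea
  rw [div_le_div_iff_of_pos_right two_pos, mul_le_mul_iff_right₀ hc,
    sq_le_sq₀ (norm_nonneg _) hd.le]

open Classical in
/-- The distance from the origin to `z` inside the sector `j`, measured by the area of the circle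
sector up to `z`. Points beyond the interference range or outside the sector are at infinity. -/
noncomputable def distIn (p : Params) (j : Fin (numSectors p)) (z : ℂ) : ℝ≥0∞ :=
  if z ∈ sector p j ∧ ‖z‖ ≤ p.dmax then ENNReal.ofReal (areaTo p.thetaC z) else ⊤

open Classical in
/-- The distance to an interfering transmitter inside the sector `j`, measured as in `distIn`.
Transmitters that do not interfere are at infinity. -/
noncomputable def interfererDist (p : Params) (j : Fin (numSectors p)) (q : Transmitter) : ℝ≥0∞ :=
  if q.2.1 = true ∧ PointsToOrigin p q.1 q.2.2 then distIn p j q.1 else ⊤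

lemma interfererDist_lt_iff {p : Params} {j : Fin (numSectors p)} {q : Transmitter} {u : ℝ≥0∞} :
    interfererDist p j q < u ↔
      (q.2.1 = true ∧ PointsToOrigin p q.1 q.2.2) ∧ distIn p j q.1 < u := by
  unfold interfererDist
  split_ifs with h <;> simp [h]

lemma measurable_distIn (p : Params) (j : Fin (numSectors p)) : Measurable (distIn p j) := by
  unfold distIn
  exact Measurable.ite ((measurableSet_sector p j).inter
    (measurableSet_le measurable_norm measurable_const))
    (measurable_areaTo _).ennreal_ofReal measurable_const

lemma measurableSet_pointsToOrigin (p : Params) :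
    MeasurableSet {q : Transmitter | PointsToOrigin p q.1 q.2.2} := by
  have h : Measurable fun q : Transmitter => ((Complex.arg (-q.1) : ℝ) : Direction) :=
    (AddCircle.continuous_mk' _).measurable.comp
      (Complex.measurable_arg.comp measurable_fst.neg)
  exact measurableSet_le (Measurable.dist (by fun_prop) h) measurable_const

lemma measurable_interfererDist (p : Params) (j : Fin (numSectors p)) :
    Measurable (interfererDist p j) := by
  unfold interfererDist
  refine Measurable.ite (MeasurableSet.inter ?_ (measurableSet_pointsToOrigin p))
    ((measurable_distIn p j).comp measurable_fst) measurable_const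
  exact (measurable_fst.comp measurable_snd) (measurableSet_singleton true)

lemma volume_distIn_lt (hc : 0 < p.thetaC) (hk : p.theta = numSectors p * p.thetaC)
    (hle : p.theta ≤ 2 * Real.pi) (hd : 0 < p.dmax) (j : Fin (numSectors p)) (u : ℝ≥0∞) :
    volume {z | distIn p j z < u} = min u (ENNReal.ofReal (sectorArea p p.dmax)) := by
  set D := sectorArea p p.dmax with hD
  have hD0 : 0 ≤ D := sectorArea_nonneg hc _
  have hm : MeasurableSet {s : ℝ | s ≤ D ∧ ENNReal.ofReal s < u} :=
    measurableSet_Iic.inter (measurableSet_lt ENNReal.measurable_ofReal measurable_const)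
  have h1 : {z | distIn p j z < u} =
      (areaTo p.thetaC ⁻¹' {s | s ≤ D ∧ ENNReal.ofReal s < u}) ∩ sector p j := by
    ext z
    simp only [distIn, Set.mem_ofPred_eq, Set.mem_inter_iff, Set.mem_preimage,
      areaTo_le_sectorArea_iff hc hd, hD]
    split_ifs with h
    · simp [h.1, h.2]
    · simp only [not_top_lt, false_iff]
      tauto
  have hmz := measurable_areaTo p.thetaC hm
  obtain ⟨hb1, hb2⟩ := sector_bounds hc hk hle j
  rw [h1, ← Measure.restrict_apply hmz, ← lintegral_indicator_one hmz, sector_eq_wedge]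
  refine (lintegral_sector_areaTo hc hb1 hb2
    (F := {s : ℝ | s ≤ D ∧ ENNReal.ofReal s < u}.indicator 1)
    (measurable_one.indicator hm)).trans ?_
  rw [lintegral_indicator_one hm, Measure.restrict_apply hm]
  rcases le_or_gt u (ENNReal.ofReal D) with h | h
  · rw [min_eq_left h]
    obtain ⟨t, ht, rfl⟩ : ∃ t : ℝ, 0 ≤ t ∧ u = ENNReal.ofReal t :=
      ⟨u.toReal, ENNReal.toReal_nonneg,
        (ENNReal.ofReal_toReal (ne_top_of_le_ne_top ENNReal.ofReal_ne_top h)).symm⟩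
    have htD : t ≤ D := (ENNReal.ofReal_le_ofReal_iff hD0).1 h
    have : {s : ℝ | s ≤ D ∧ ENNReal.ofReal s < ENNReal.ofReal t} ∩ Set.Ioi 0 = Set.Ioo 0 t := by
      ext s
      simp only [Set.mem_inter_iff, Set.mem_ofPred_eq, Set.mem_Ioi, Set.mem_Ioo]
      constructor
      · rintro ⟨⟨-, h2⟩, h3⟩
        exact ⟨h3, lt_of_not_ge fun h => h2.not_ge (ENNReal.ofReal_le_ofReal h)⟩
      · rintro ⟨h2, h3⟩
        exact ⟨⟨by linarith, (ENNReal.ofReal_lt_ofReal_iff (h2.trans h3)).2 h3⟩, h2⟩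
    rw [this, Real.volume_Ioo, sub_zero]
  · rw [min_eq_right h.le]
    have : {s : ℝ | s ≤ D ∧ ENNReal.ofReal s < u} ∩ Set.Ioi 0 = Set.Ioc 0 D := by
      ext s
      simp only [Set.mem_inter_iff, Set.mem_ofPred_eq, Set.mem_Ioi, Set.mem_Ioc]
      constructor
      · rintro ⟨⟨h2, -⟩, h3⟩
        exact ⟨h3, h2⟩
      · rintro ⟨h2, h3⟩
        exact ⟨⟨h3, (ENNReal.ofReal_le_ofReal h3).trans_lt h⟩, h2⟩
    rw [this, Real.volume_Ioc, sub_zero]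

lemma distIn_lt_top_iff {j : Fin (numSectors p)} {z : ℂ} :
    distIn p j z < ⊤ ↔ z ∈ sector p j ∧ ‖z‖ ≤ p.dmax := by
  unfold distIn
  split_ifs with h <;> simp [h]

lemma volume_iUnion_distIn_lt (hc : 0 < p.thetaC) (hk : p.theta = numSectors p * p.thetaC)
    (hle : p.theta ≤ 2 * Real.pi) (hd : 0 < p.dmax) (u : Fin (numSectors p) → ℝ≥0∞) :
    volume (⋃ j, {z | distIn p j z < u j}) =
      ∑ j, min (u j) (ENNReal.ofReal (sectorArea p p.dmax)) := by
  rw [measure_iUnion, tsum_fintype]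
  · simp_rw [volume_distIn_lt hc hk hle hd]
  · intro i j hij
    refine Set.disjoint_left.2 fun z hz hz' => hij (Fin.ext ?_)
    exact sector_index_unique hc (distIn_lt_top_iff.1 (lt_top_of_lt hz)).1
      (distIn_lt_top_iff.1 (lt_top_of_lt hz')).1
  · exact fun j => measurableSet_lt (measurable_distIn p j) measurable_const

lemma haarAddCircle_closedBall (x : Direction) {t : ℝ} (ht : t ≤ 2 * Real.pi) :
    AddCircle.haarAddCircle (Metric.closedBall x (t / 2)) = ENNReal.ofReal (t / (2 * Real.pi)) := by
  have h := AddCircle.volume_closedBall (T := 2 * Real.pi) (x := x) (t / 2)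
  rw [AddCircle.volume_eq_smul_haarAddCircle, Measure.smul_apply, smul_eq_mul,
    mul_div_cancel₀ _ two_ne_zero, min_eq_right ht] at h
  rw [ENNReal.ofReal_div_of_pos Real.two_pi_pos, ENNReal.eq_div_iff _ ENNReal.ofReal_ne_top, h]
  simpa using Real.pi_pos

lemma bernoulliMeasure_true (r : unitInterval) :
    bernoulliMeasure true false r {true} = ENNReal.ofReal (r : ℝ) := by
  classical
  rw [bernoulliMeasure_apply _ (measurableSet_singleton true)]
  simp [ENNReal.ofReal, unitInterval.toNNReal, Real.toNNReal, r.2.1]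
  rfl

/-- Thinning: above each position in the region the admissible marks are "active" times a ball of
axes, whose probability `rhoA * theta / (2π)` does not depend on the position. -/
lemma measure_iUnion_interfererDist_lt (htheta : 0 < p.theta)
    (hle : p.theta ≤ 2 * Real.pi) (u : Fin (numSectors p) → ℝ≥0∞) :
    ((ENNReal.ofReal p.lamT • (volume : Measure ℂ)).prod
      ((bernoulliMeasure true false p.rhoA).prod AddCircle.haarAddCircle))
        (⋃ j, {q | interfererDist p j q < u j}) =
      ENNReal.ofReal (lamI p) * volume (⋃ j, {z | distIn p j z < u j}) := by
  have hm : MeasurableSet (⋃ j, {q | interfererDist p j q < u j}) :=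
    .iUnion fun j => measurableSet_lt (measurable_interfererDist p j) measurable_const
  have hmB : MeasurableSet (⋃ j, {z | distIn p j z < u j}) :=
    .iUnion fun j => measurableSet_lt (measurable_distIn p j) measurable_const
  rw [Measure.prod_apply hm]
  have h1 : ∀ y : ℂ, ((bernoulliMeasure true false p.rhoA).prod AddCircle.haarAddCircle)
      (Prod.mk y ⁻¹' (⋃ j, {q : Transmitter | interfererDist p j q < u j})) =
      (⋃ j, {z | distIn p j z < u j}).indicator (fun _ =>
        ENNReal.ofReal p.rhoA * ENNReal.ofReal (p.theta / (2 * Real.pi))) y := by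
    intro y
    by_cases hy : y ∈ ⋃ j, {z | distIn p j z < u j}
    · rw [Set.indicator_of_mem hy, ← bernoulliMeasure_true, ← haarAddCircle_closedBall
        ((Complex.arg (-y) : ℝ) : Direction) hle, ← Measure.prod_prod]
      congr 1
      obtain ⟨j, hj⟩ := Set.mem_iUnion.1 hy
      ext ⟨a, φ⟩
      simp only [Set.mem_preimage, Set.mem_iUnion, Set.mem_ofPred_eq, Set.mem_prod,
        Set.mem_singleton_iff, interfererDist_lt_iff, PointsToOrigin] at hj ⊢
      -- The condition on the mark is the same for all sectors, so any sector witnessing the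
      -- position will do.
      exact ⟨fun ⟨i, hi⟩ => hi.1, fun h => ⟨j, h, hj⟩⟩
    · rw [Set.indicator_of_notMem hy, Set.eq_empty_of_forall_notMem (s := Prod.mk y ⁻¹' _)
        fun x hx => hy ?_, measure_empty]
      obtain ⟨j, hj⟩ := Set.mem_iUnion.1 hx
      exact Set.mem_iUnion.2 ⟨j, (interfererDist_lt_iff.1 hj).2⟩
  simp_rw [h1]
  rw [lintegral_indicator hmB, setLIntegral_const, Measure.smul_apply, smul_eq_mul, lamI,
    ← ENNReal.ofReal_mul p.rhoA.2.1, ← mul_assoc, ← ENNReal.ofReal_mul (by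
      have := p.rhoA.2.1
      positivity)]
  congr 2
  ring

end Sectors

/-! ### Product laws over the sectors. -/

section ProductLaw

variable {ι : Type*} [Fintype ι]

/-- Upper orthants are the boxes of the π-system of sets `Ici`, which generates the Borel sets, so
the joint tails determine the law. -/
lemma pi_censoredExp_eq {a D : ℝ} (ha : 0 < a) (hD : 0 ≤ D) {ν : Measure (ι → ℝ≥0∞)}
    (h : ∀ u : ι → ℝ≥0∞, ν {v | ∀ i, u i ≤ v i} = ∏ i, censoredTail a D (u i)) :
    Measure.pi (fun _ : ι => censoredExp a D) = ν := by
  have := isProbabilityMeasure_censoredExp ha hD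
  refine Measure.pi_eq_generateFrom (C := fun _ => Set.range Set.Ici)
    (fun _ => ?_) (fun _ => isPiSystem_Ici) (fun _ => ?_) ?_
  · rw [← borel_eq_generateFrom_Ici, ← BorelSpace.measurable_eq]
  · exact ⟨fun _ => Set.univ, fun _ => ⟨0, by simp⟩, fun _ => measure_lt_top _ _,
      Set.iUnion_const _⟩
  · intro s hs
    choose u hu using hs
    have : Set.univ.pi s = {v | ∀ i, u i ≤ v i} := by
      ext v
      simp [← hu]
    rw [this, h]
    refine Finset.prod_congr rfl fun i _ => ?_
    rw [← hu, censoredExp_Ici ha hD]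

lemma prod_censoredTail (a D : ℝ) (u : ι → ℝ≥0∞) :
    ∏ i, censoredTail a D (u i) =
      ENNReal.ofReal (Real.exp (-(a * (∑ i, min (u i) (ENNReal.ofReal D)).toReal))) := by
  rw [ENNReal.toReal_sum fun i _ => ne_top_of_le_ne_top ENNReal.ofReal_ne_top (min_le_right _ _),
    Finset.mul_sum, ← Finset.sum_neg_distrib, Real.exp_sum,
    ENNReal.ofReal_prod_of_nonneg fun _ _ => (Real.exp_pos _).le]
  rfl

/-- The constraint on coordinate `j` is absorbed into the `j`-th factor; the integral of the product
then factorizes. -/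
lemma lintegral_pi_indicator_prod [DecidableEq ι] {κ : Measure ℝ≥0∞} [IsProbabilityMeasure κ]
    {T : ℝ≥0∞ → ℝ≥0∞} (hT : Measurable T) {B : Set ℝ≥0∞} (hB : MeasurableSet B) (j : ι) :
    ∫⁻ u, {u : ι → ℝ≥0∞ | u j ∈ B}.indicator (fun u => ∏ i, T (u i)) u
        ∂(Measure.pi fun _ : ι => κ) =
      (∫⁻ x, T x ∂κ) ^ (Fintype.card ι - 1) * ∫⁻ x in B, T x ∂κ := by
  have hmeas : ∀ i, Measurable (if i = j then B.indicator T else T) := fun i => by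
    split_ifs
    exacts [hT.indicator hB, hT]
  have h1 : ∀ u : ι → ℝ≥0∞, {u : ι → ℝ≥0∞ | u j ∈ B}.indicator (fun u => ∏ i, T (u i)) u =
      ∏ i, (if i = j then B.indicator T else T) (u i) := by
    intro u
    by_cases hu : u j ∈ B
    · rw [Set.indicator_of_mem (by exact hu)]
      refine Finset.prod_congr rfl fun i _ => ?_
      split_ifs with h
      · rw [h, Set.indicator_of_mem hu]
      · rfl
    · rw [Set.indicator_of_notMem (by exact hu)]
      exact (Finset.prod_eq_zero (Finset.mem_univ j) (by simp [hu])).symm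
  simp_rw [h1]
  rw [lintegral_prod_eq_prod_lintegral_of_indepFun Finset.univ
    (fun i (u : ι → ℝ≥0∞) => (if i = j then B.indicator T else T) (u i))
    (iIndepFun_pi fun i => (hmeas i).aemeasurable) (fun i => (hmeas i).comp (measurable_pi_apply i))]
  have h2 : ∀ i, ∫⁻ u : ι → ℝ≥0∞, (if i = j then B.indicator T else T) (u i)
      ∂(Measure.pi fun _ : ι => κ) = ∫⁻ x, (if i = j then B.indicator T else T) x ∂κ := fun i =>
    (measurePreserving_eval (fun _ : ι => κ) i).lintegral_comp (hmeas i)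
  simp_rw [h2]
  rw [← Finset.mul_prod_erase _ _ (Finset.mem_univ j), if_pos rfl, lintegral_indicator hB, mul_comm,
    Finset.prod_congr rfl fun i hi => by rw [if_neg (Finset.ne_of_mem_erase hi)]]
  simp [Finset.card_erase_of_mem]

end ProductLaw

/-! ### Line of sight and collision in terms of nearest points. -/

section Deterministic

variable {p : Params}

lemma distIn_le_areaTo_iff (hc : 0 < p.thetaC) {j : Fin (numSectors p)} {x z : ℂ} :
    distIn p j x ≤ ENNReal.ofReal (areaTo p.thetaC z) ↔
      (x ∈ sector p j ∧ ‖x‖ ≤ p.dmax) ∧ ‖x‖ ≤ ‖z‖ := by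
  unfold distIn
  split_ifs with h
  · simp [h, ENNReal.ofReal_le_ofReal_iff (areaTo_nonneg hc.le z), areaTo_le_iff hc]
  · simp [h]

/-- The inequality is strict because an obstacle at equal distance blocks. Obstacles beyond `dmax`,
invisible to `distIn`, cannot block since `‖z‖ ≤ dmax`. -/
lemma not_blocked_iff (hc : 0 < p.thetaC) {O : Set ℂ}
    (hO : ∀ j, (O ∩ {x | distIn p j x < ⊤}).Finite) {z : ℂ} {j : Fin (numSectors p)}
    (hz : z ∈ sector p j) (hzd : ‖z‖ ≤ p.dmax) :
    ¬ Blocked p O z ↔ ENNReal.ofReal (areaTo p.thetaC z) < nearest (distIn p) O j := by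
  rw [lt_nearest_iff (hO j) ENNReal.ofReal_ne_top]
  constructor
  · intro h x hx
    by_contra hn
    obtain ⟨⟨h1, -⟩, h2⟩ := (distIn_le_areaTo_iff hc).1 (not_lt.1 hn)
    exact h ⟨j, j.2, hz, x, hx, h1, h2⟩
  · rintro h ⟨i, -, hzi, x, hx, hxi, hxz⟩
    obtain rfl := sector_index_unique hc hz hzi
    exact (h x hx).not_ge ((distIn_le_areaTo_iff hc).2 ⟨⟨hxi, hxz.trans hzd⟩, hxz⟩)

/-- A collision needs an interferer strictly nearer than every obstacle of its sector. Ties are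
blocked, hence `≤`; a sector without interferers in range has `⊤` on the right. -/
lemma not_collision_iff (hc : 0 < p.thetaC) (hk : p.theta = numSectors p * p.thetaC) {O : Set ℂ}
    (hO : ∀ j, (O ∩ {x | distIn p j x < ⊤}).Finite) (Φ : Set Transmitter) :
    ¬ Collision p O {q | (q.1, true, q.2) ∈ Φ} ↔
      ∀ j, nearest (distIn p) O j ≤ nearest (interfererDist p) Φ j := by
  rw [not_iff_comm]
  push Not
  simp_rw [nearest_lt_iff, interfererDist_lt_iff]
  constructor
  · rintro ⟨j, ⟨y, a, φ⟩, hq, ⟨ha, hpt⟩, hlt⟩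
    simp only at ha hpt hlt
    obtain ⟨hy, hyd⟩ := distIn_lt_top_iff.1 (lt_top_of_lt hlt)
    subst ha
    refine ⟨(y, φ), hq, hpt, (mem_mainLobe_iff hc hk).2 ⟨j, hy⟩, hyd, ?_⟩
    rw [not_blocked_iff hc hO hy hyd]
    simpa [distIn, hy, hyd] using hlt
  · rintro ⟨⟨y, φ⟩, hq, hpt, hm, hyd, hb⟩
    obtain ⟨j, hy⟩ := (mem_mainLobe_iff hc hk).1 hm
    rw [not_blocked_iff hc hO hy hyd] at hb
    exact ⟨j, (y, true, φ), hq, ⟨rfl, hpt⟩, by simpa [distIn, hy, hyd] using hb⟩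

/-- The pairs of a position `z` and of distances of the nearest obstacles in the sectors for which
`z` is in line of sight. -/
def clearSet (p : Params) : Set (ℂ × (Fin (numSectors p) → ℝ≥0∞)) :=
  {x | ∃ j : Fin (numSectors p), x.1 ∈ sector p j ∧ ENNReal.ofReal (areaTo p.thetaC x.1) < x.2 j}

lemma measurableSet_clearSet (p : Params) : MeasurableSet (clearSet p) := by
  rw [clearSet, Set.ofPred_exists]
  refine .iUnion fun j => MeasurableSet.inter (measurable_fst (measurableSet_sector p j))
    (measurableSet_lt ((measurable_areaTo _).comp measurable_fst).ennreal_ofReal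
      ((measurable_pi_apply j).comp measurable_snd))

lemma mem_clearSet_iff (hc : 0 < p.thetaC) {z : ℂ} {u : Fin (numSectors p) → ℝ≥0∞}
    {j : Fin (numSectors p)} (hz : z ∈ sector p j) :
    (z, u) ∈ clearSet p ↔ ENNReal.ofReal (areaTo p.thetaC z) < u j := by
  constructor
  · rintro ⟨i, hi, h⟩
    obtain rfl := Fin.ext (sector_index_unique hc hi hz)
    exact h
  · exact fun h => ⟨j, hz, h⟩

lemma not_blocked_iff_mem_clearSet (hc : 0 < p.thetaC) (hk : p.theta = numSectors p * p.thetaC)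
    {O : Set ℂ} (hO : ∀ j, (O ∩ {x | distIn p j x < ⊤}).Finite) {z : ℂ} (hz : z ∈ mainLobe p)
    (hzd : ‖z‖ ≤ p.dmax) : ¬ Blocked p O z ↔ (z, nearest (distIn p) O) ∈ clearSet p := by
  obtain ⟨j, hj⟩ := (mem_mainLobe_iff hc hk).1 hz
  rw [not_blocked_iff hc hO hj hzd, mem_clearSet_iff hc hj]

end Deterministic

/-! ### Averaging over the position of the intended transmitter. -/

section TypicalPosition

variable {p : Params}

/-- The area coordinate of a uniform point of the lobe is uniform on `(0, D]`. The identity `key` is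
applied both to `F` and to `1`, and the angle factors cancel in the quotient. -/
lemma lintegral_typPos_areaTo (hc : 0 < p.thetaC) (htheta : 0 < p.theta)
    (hle : p.theta ≤ 2 * Real.pi) (hd : 0 < p.dmax) {F : ℝ → ℝ≥0∞} (hF : Measurable F) :
    ∫⁻ z, F (areaTo p.thetaC z) ∂(cond volume (mainLobe p ∩ Metric.closedBall 0 p.dmax)) =
      (ENNReal.ofReal (sectorArea p p.dmax))⁻¹ *
        ∫⁻ s in Set.Ioc 0 (sectorArea p p.dmax), F s := by
  set D := sectorArea p p.dmax with hD
  have hD0 : 0 < D := by rw [hD]; unfold sectorArea; positivity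
  have hset : mainLobe p ∩ Metric.closedBall 0 p.dmax =
      (areaTo p.thetaC ⁻¹' Set.Iic D) ∩ mainLobe p := by
    ext z
    simp [areaTo_le_sectorArea_iff hc hd, hD, and_comm]
  have hmD := measurable_areaTo p.thetaC (measurableSet_Iic (a := D))
  have key : ∀ {F : ℝ → ℝ≥0∞}, Measurable F → ENNReal.ofReal p.thetaC *
      ∫⁻ z in mainLobe p ∩ Metric.closedBall 0 p.dmax, F (areaTo p.thetaC z) =
        ENNReal.ofReal p.theta * ∫⁻ s in Set.Ioc 0 D, F s := by
    intro F hF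
    have h := lintegral_wedge_areaTo hc (α := -(p.theta / 2)) (β := p.theta / 2) (by linarith)
      (by linarith) (hF.indicator (measurableSet_Iic (a := D)))
    rw [setLIntegral_indicator measurableSet_Iic, Set.Iic_inter_Ioi,
      show p.theta / 2 - -(p.theta / 2) = p.theta by ring] at h
    rw [← h, hset, ← setLIntegral_indicator hmD]
    rfl
  have hθ : ENNReal.ofReal p.theta ≠ 0 := by simpa using htheta
  have hθc : ENNReal.ofReal p.thetaC ≠ 0 := by simpa using hc
  have hvol := key (F := 1) measurable_one
  simp only [Pi.one_apply, setLIntegral_one, Real.volume_Ioc, sub_zero] at hvol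
  rw [ProbabilityTheory.cond, lintegral_smul_measure, smul_eq_mul]
  have hX := key hF
  set X := ∫⁻ z in mainLobe p ∩ Metric.closedBall 0 p.dmax, F (areaTo p.thetaC z)
  set v := volume (mainLobe p ∩ Metric.closedBall 0 p.dmax)
  have hDE : ENNReal.ofReal D ≠ 0 := by simpa using hD0
  calc v⁻¹ * X = (ENNReal.ofReal p.thetaC * v)⁻¹ * (ENNReal.ofReal p.thetaC * X) := by
        rw [ENNReal.mul_inv (Or.inl hθc) (Or.inl ENNReal.ofReal_ne_top), mul_mul_mul_comm,
          ENNReal.inv_mul_cancel hθc ENNReal.ofReal_ne_top, one_mul]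
    _ = _ := by
        rw [hvol, hX, ENNReal.mul_inv (Or.inl hθ) (Or.inl ENNReal.ofReal_ne_top), mul_mul_mul_comm,
          ENNReal.inv_mul_cancel hθ ENNReal.ofReal_ne_top, one_mul]

/-- The probability, given a link of length with sector area `s`, that the link is in line of sight
and that no interferer is in line of sight, when interferers have density `b`. -/
noncomputable def clearProb (p : Params) (b s : ℝ) : ℝ :=
  ((p.lamO + b * Real.exp (-((p.lamO + b) * sectorArea p p.dmax))) / (p.lamO + b)) ^
      (numSectors p - 1) *
    (p.lamO / (p.lamO + b) *
      (Real.exp (-((p.lamO + b) * s)) - Real.exp (-((p.lamO + b) * sectorArea p p.dmax))) +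
        Real.exp (-((p.lamO + b) * sectorArea p p.dmax)))

lemma continuous_clearProb (p : Params) (b : ℝ) : Continuous (clearProb p b) := by
  unfold clearProb; fun_prop

lemma clearProb_nonneg (hlamO : 0 < p.lamO) {b : ℝ} (hb : 0 ≤ b) {s : ℝ}
    (hs : s ≤ sectorArea p p.dmax) : 0 ≤ clearProb p b s := by
  unfold clearProb
  have : Real.exp (-((p.lamO + b) * sectorArea p p.dmax)) ≤ Real.exp (-((p.lamO + b) * s)) :=
    Real.exp_le_exp.2 (neg_le_neg (mul_le_mul_of_nonneg_left hs (by positivity)))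
  have := sub_nonneg.2 this
  positivity

/-- The sector of `z` gives the integral over obstacles beyond `z`; the other `numSectors p - 1`
sectors give the unrestricted one. -/
lemma lintegral_clearSet (hc : 0 < p.thetaC) (hk : p.theta = numSectors p * p.thetaC)
    (hlamO : 0 < p.lamO) {b : ℝ} (hb : 0 ≤ b) {z : ℂ}
    (hz : z ∈ mainLobe p) (hzd : areaTo p.thetaC z ≤ sectorArea p p.dmax) :
    ∫⁻ u, (clearSet p).indicator
        (fun x => ∏ i, censoredTail b (sectorArea p p.dmax) (x.2 i)) (z, u)
        ∂(Measure.pi fun _ => censoredExp p.lamO (sectorArea p p.dmax)) =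
      ENNReal.ofReal (clearProb p b (areaTo p.thetaC z)) := by
  classical
  set D := sectorArea p p.dmax with hD
  have hD0 : 0 ≤ D := sectorArea_nonneg hc _
  have := isProbabilityMeasure_censoredExp hlamO hD0
  obtain ⟨j, hj⟩ := (mem_mainLobe_iff hc hk).1 hz
  have h1 : ∀ u : Fin (numSectors p) → ℝ≥0∞, (clearSet p).indicator
        (fun x => ∏ i, censoredTail b D (x.2 i)) (z, u) =
      {u : Fin (numSectors p) → ℝ≥0∞ |
        u j ∈ Set.Ioi (ENNReal.ofReal (areaTo p.thetaC z))}.indicator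
          (fun u => ∏ i, censoredTail b D (u i)) u := by
    intro u
    simp only [Set.indicator_apply, mem_clearSet_iff hc hj, Set.mem_ofPred_eq, Set.mem_Ioi]
  simp_rw [h1]
  rw [lintegral_pi_indicator_prod (measurable_censoredTail b D) measurableSet_Ioi,
    lintegral_censoredExp_univ hlamO hb hD0,
    lintegral_censoredExp_Ioi hlamO hb (areaTo_nonneg hc.le z) hzd, Fintype.card_fin,
    ← ENNReal.ofReal_pow (by positivity), ← ENNReal.ofReal_mul (by positivity)]
  rfl

lemma lintegral_lintegral_clearSet (hc : 0 < p.thetaC) (hk : p.theta = numSectors p * p.thetaC)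
    (htheta : 0 < p.theta) (hle : p.theta ≤ 2 * Real.pi) (hd : 0 < p.dmax)
    (hlamO : 0 < p.lamO) {b : ℝ} (hb : 0 ≤ b) :
    ∫⁻ z, ∫⁻ u, (clearSet p).indicator
        (fun x => ∏ i, censoredTail b (sectorArea p p.dmax) (x.2 i)) (z, u)
        ∂(Measure.pi fun _ => censoredExp p.lamO (sectorArea p p.dmax))
        ∂(cond volume (mainLobe p ∩ Metric.closedBall 0 p.dmax)) =
      ENNReal.ofReal ((sectorArea p p.dmax)⁻¹ *
        ∫ s in (0 : ℝ)..sectorArea p p.dmax, clearProb p b s) := by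
  have hD0 : 0 < sectorArea p p.dmax := by unfold sectorArea; positivity
  rw [lintegral_congr_ae (g := fun z => ENNReal.ofReal (clearProb p b (areaTo p.thetaC z))),
    lintegral_typPos_areaTo hc htheta hle hd
      (F := fun s => ENNReal.ofReal (clearProb p b s))
      (continuous_clearProb p b).measurable.ennreal_ofReal,
    ENNReal.ofReal_mul (by positivity), ENNReal.ofReal_inv_of_pos hD0,
    intervalIntegral.integral_of_le hD0.le, ofReal_integral_eq_lintegral_ofReal]
  · exact (continuous_clearProb p b).integrableOn_Icc.mono_set Set.Ioc_subset_Icc_self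
  · filter_upwards [ae_restrict_mem measurableSet_Ioc] with s hs
    exact clearProb_nonneg hlamO hb hs.2
  · filter_upwards [ae_cond_mem ((measurableSet_mainLobe p).inter
      Metric.isClosed_closedBall.measurableSet)] with z hz
    exact lintegral_clearSet hc hk hlamO hb hz.1
      ((areaTo_le_sectorArea_iff hc hd).2 (by simpa using hz.2))

end TypicalPosition

/-! ### Laws and independence in the network; success probabilities. -/

section Network

variable {Ω : Type*} {p : Params} {S : Ω → Snapshot}

/-- The sigma-algebras of the four independent parts of a network. -/
@[reducible] noncomputable def partSigma (S : Ω → Snapshot) : Fin 4 → MeasurableSpace Ω :=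
  ![countSigma (fun ω => (S ω).tx), countSigma (fun ω => (S ω).obst),
    MeasurableSpace.comap (fun ω => (S ω).typPos) inferInstance,
    MeasurableSpace.comap (fun ω => (S ω).typActive) inferInstance]

lemma measurable_of_partSigma {β : Type*} [MeasurableSpace β] {X : Ω → β} {T : Set (Fin 4)}
    {i : Fin 4} (hi : i ∈ T) (hX : Measurable[partSigma S i] X) :
    Measurable[⨆ i ∈ T, partSigma S i] X :=
  hX.mono (le_iSup₂ (f := fun i (_ : i ∈ T) => partSigma S i) i hi) le_rfl

/-- The distances of the nearest obstacles in the sectors. -/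
noncomputable def obstDist (p : Params) (S : Ω → Snapshot) (ω : Ω) : Fin (numSectors p) → ℝ≥0∞ :=
  nearest (distIn p) (S ω).obst

/-- The distances of the nearest interferers in the sectors. -/
noncomputable def txDist (p : Params) (S : Ω → Snapshot) (ω : Ω) : Fin (numSectors p) → ℝ≥0∞ :=
  nearest (interfererDist p) (S ω).tx

lemma measurable_txDist_partSigma (p : Params) (S : Ω → Snapshot) :
    Measurable[partSigma S 0] (txDist p S) :=
  measurable_nearest _ (measurable_interfererDist p)

lemma measurable_obstDist_partSigma (p : Params) (S : Ω → Snapshot) :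
    Measurable[partSigma S 1] (obstDist p S) :=
  measurable_nearest _ (measurable_distIn p)

lemma measurable_typPos_partSigma (S : Ω → Snapshot) :
    Measurable[partSigma S 2] fun ω => (S ω).typPos :=
  comap_measurable _

lemma measurable_typActive_partSigma (S : Ω → Snapshot) :
    Measurable[partSigma S 3] fun ω => (S ω).typActive :=
  comap_measurable _

variable [mΩ : MeasurableSpace Ω] {P : Measure Ω}

lemma IsNetwork.partSigma_le (hS : IsNetwork P p S) (i : Fin 4) : partSigma S i ≤ mΩ := by
  fin_cases i
  · exact hS.poisson_tx.countSigma_le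
  · exact hS.poisson_obst.countSigma_le
  · exact hS.measurable_typPos.comap_le
  · exact hS.measurable_typActive.comap_le

lemma IsNetwork.indepFun (hS : IsNetwork P p S) {β γ : Type*} [MeasurableSpace β]
    [MeasurableSpace γ] {X : Ω → β} {Y : Ω → γ} {T T' : Set (Fin 4)} (hT : Disjoint T T')
    (hX : Measurable[⨆ i ∈ T, partSigma S i] X) (hY : Measurable[⨆ i ∈ T', partSigma S i] Y) :
    IndepFun X Y P := by
  have h := indep_iSup_of_disjoint hS.partSigma_le hS.indep hT
  exact indep_of_indep_of_le_right (indep_of_indep_of_le_left h hX.comap_le) hY.comap_le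

lemma IsNetwork.measurable_obstDist (hS : IsNetwork P p S) : Measurable (obstDist p S) :=
  (measurable_obstDist_partSigma p S).mono (hS.partSigma_le 1) le_rfl

lemma IsNetwork.measurable_txDist (hS : IsNetwork P p S) : Measurable (txDist p S) :=
  (measurable_txDist_partSigma p S).mono (hS.partSigma_le 0) le_rfl

lemma sum_min_ofReal_lt_top {ι : Type*} [Fintype ι] (u : ι → ℝ≥0∞) (D : ℝ) :
    ∑ i, min (u i) (ENNReal.ofReal D) < ⊤ :=
  ENNReal.sum_lt_top.2 fun _ _ => (min_le_right _ _).trans_lt ENNReal.ofReal_lt_top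

lemma IsNetwork.map_obstDist (hS : IsNetwork P p S) (hlamO : 0 < p.lamO) (hc : 0 < p.thetaC)
    (hk : p.theta = numSectors p * p.thetaC) (hle : p.theta ≤ 2 * Real.pi) (hd : 0 < p.dmax) :
    P.map (obstDist p S) =
      Measure.pi fun _ => censoredExp p.lamO (sectorArea p p.dmax) := by
  refine (pi_censoredExp_eq hlamO (sectorArea_nonneg hc _) fun u => ?_).symm
  have hm : MeasurableSet {v : Fin (numSectors p) → ℝ≥0∞ | ∀ i, u i ≤ v i} := by
    rw [Set.ofPred_forall]
    exact .iInter fun i => measurableSet_le measurable_const (measurable_pi_apply i)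
  have hμ := volume_iUnion_distIn_lt hc hk hle hd u
  rw [Measure.map_apply hS.measurable_obstDist hm, prod_censoredTail, ← hμ]
  have hfin : (ENNReal.ofReal p.lamO • (volume : Measure ℂ)) (⋃ j, {z | distIn p j z < u j}) < ⊤ := by
    rw [Measure.smul_apply, smul_eq_mul, hμ]
    exact ENNReal.mul_lt_top ENNReal.ofReal_lt_top (sum_min_ofReal_lt_top _ _)
  refine (hS.poisson_obst.measure_le_nearest (measurable_distIn p) u hfin).trans ?_
  rw [Measure.smul_apply, smul_eq_mul, ENNReal.toReal_mul, ENNReal.toReal_ofReal hlamO.le]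

lemma lamI_nonneg (hlamT : 0 ≤ p.lamT) (htheta : 0 ≤ p.theta) : 0 ≤ lamI p := by
  have := p.rhoA.2.1
  unfold lamI
  positivity

/-- Only orthant probabilities are needed here. The rate `lamI p` may be zero, when `rhoA = 0`,
whereas `pi_censoredExp_eq` asks for a positive rate. -/
lemma IsNetwork.map_txDist (hS : IsNetwork P p S) (hlamT : 0 < p.lamT) (htheta : 0 < p.theta)
    (hc : 0 < p.thetaC) (hk : p.theta = numSectors p * p.thetaC) (hle : p.theta ≤ 2 * Real.pi)
    (hd : 0 < p.dmax) (u : Fin (numSectors p) → ℝ≥0∞) :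
    P.map (txDist p S) {v | ∀ i, u i ≤ v i} =
      ∏ i, censoredTail (lamI p) (sectorArea p p.dmax) (u i) := by
  have hm : MeasurableSet {v : Fin (numSectors p) → ℝ≥0∞ | ∀ i, u i ≤ v i} := by
    rw [Set.ofPred_forall]
    exact .iInter fun i => measurableSet_le measurable_const (measurable_pi_apply i)
  have hμ := volume_iUnion_distIn_lt hc hk hle hd u
  have hμ' := measure_iUnion_interfererDist_lt htheta hle u
  rw [Measure.map_apply hS.measurable_txDist hm, prod_censoredTail, ← hμ]
  have hfin := (ENNReal.mul_lt_top (ENNReal.ofReal_lt_top (r := lamI p))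
    (sum_min_ofReal_lt_top u (sectorArea p p.dmax)))
  rw [← hμ, ← hμ'] at hfin
  refine (hS.poisson_tx.measure_le_nearest (measurable_interfererDist p) u hfin).trans ?_
  rw [hμ', ENNReal.toReal_mul, ENNReal.toReal_ofReal (lamI_nonneg hlamT.le htheta.le)]

lemma IsNetwork.ae_finite_obst (hS : IsNetwork P p S) (hc : 0 < p.thetaC)
    (hk : p.theta = numSectors p * p.thetaC) (hle : p.theta ≤ 2 * Real.pi) (hd : 0 < p.dmax) :
    ∀ᵐ ω ∂P, ∀ j, ((S ω).obst ∩ {x | distIn p j x < ⊤}).Finite := by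
  refine ae_all_iff.2 fun j => hS.poisson_obst.ae_finite
    (measurableSet_lt (measurable_distIn p j) measurable_const) ?_
  rw [Measure.smul_apply, smul_eq_mul, volume_distIn_lt hc hk hle hd]
  exact ENNReal.mul_lt_top ENNReal.ofReal_lt_top ((min_le_right _ _).trans_lt ENNReal.ofReal_lt_top)

lemma IsNetwork.ae_typPos_mem (hS : IsNetwork P p S) :
    ∀ᵐ ω ∂P, (S ω).typPos ∈ mainLobe p ∧ ‖(S ω).typPos‖ ≤ p.dmax := by
  have hm : MeasurableSet (mainLobe p ∩ Metric.closedBall (0 : ℂ) p.dmax) :=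
    (measurableSet_mainLobe p).inter Metric.isClosed_closedBall.measurableSet
  have h := ae_cond_mem (μ := volume) hm
  rw [← hS.law_typPos] at h
  filter_upwards [ae_of_ae_map hS.measurable_typPos.aemeasurable h] with ω hω
  exact ⟨hω.1, by simpa using hω.2⟩

lemma IsNetwork.ae_success_iff (hS : IsNetwork P p S) (hc : 0 < p.thetaC)
    (hk : p.theta = numSectors p * p.thetaC) (hle : p.theta ≤ 2 * Real.pi) (hd : 0 < p.dmax) :
    ∀ᵐ ω ∂P, Success p (S ω) ((S ω).typActive = true) {q | (q.1, true, q.2) ∈ (S ω).tx} ↔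
      (S ω).typActive = true ∧ ((S ω).typPos, obstDist p S ω) ∈ clearSet p ∧
        ∀ j, obstDist p S ω j ≤ txDist p S ω j := by
  filter_upwards [hS.ae_finite_obst hc hk hle hd, hS.ae_typPos_mem] with ω hO hZ
  rw [Success, not_blocked_iff_mem_clearSet hc hk hO hZ.1 hZ.2, not_collision_iff hc hk hO]
  rfl

lemma IsNetwork.ae_success_empty_iff (hS : IsNetwork P p S) (hc : 0 < p.thetaC)
    (hk : p.theta = numSectors p * p.thetaC) (hle : p.theta ≤ 2 * Real.pi) (hd : 0 < p.dmax) :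
    ∀ᵐ ω ∂P, ∀ sends : Prop, Success p (S ω) sends ∅ ↔
      sends ∧ ((S ω).typPos, obstDist p S ω) ∈ clearSet p := by
  filter_upwards [hS.ae_finite_obst hc hk hle hd, hS.ae_typPos_mem] with ω hO hZ sends
  rw [Success, not_blocked_iff_mem_clearSet hc hk hO hZ.1 hZ.2]
  simp [Collision, obstDist]

lemma IsNetwork.map_typPos_obstDist [IsProbabilityMeasure P] (hS : IsNetwork P p S) :
    P.map (fun ω => ((S ω).typPos, obstDist p S ω)) =
      (P.map fun ω => (S ω).typPos).prod (P.map (obstDist p S)) :=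
  (indepFun_iff_map_prod_eq_prod_map_map hS.measurable_typPos.aemeasurable
    hS.measurable_obstDist.aemeasurable).1
    (hS.indepFun (T := {2}) (T' := {1}) (by simp)
      (measurable_of_partSigma rfl (measurable_typPos_partSigma S))
      (measurable_of_partSigma rfl (measurable_obstDist_partSigma p S)))

lemma IsNetwork.measure_clear [IsProbabilityMeasure P] (hS : IsNetwork P p S)
    (hlamO : 0 < p.lamO) (hc : 0 < p.thetaC) (htheta : 0 < p.theta)
    (hk : p.theta = numSectors p * p.thetaC) (hle : p.theta ≤ 2 * Real.pi) (hd : 0 < p.dmax) :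
    P {ω | ((S ω).typPos, obstDist p S ω) ∈ clearSet p} =
      ENNReal.ofReal ((sectorArea p p.dmax)⁻¹ *
        ∫ s in (0 : ℝ)..sectorArea p p.dmax, clearProb p 0 s) := by
  have := isProbabilityMeasure_censoredExp hlamO (sectorArea_nonneg hc p.dmax)
  have hm := measurableSet_clearSet p
  rw [← lintegral_lintegral_clearSet hc hk htheta hle hd hlamO le_rfl, ← hS.law_typPos,
    ← hS.map_obstDist hlamO hc hk hle hd]
  simp_rw [censoredTail_zero, Pi.one_apply, Finset.prod_const_one]
  rw [← lintegral_prod _ ((measurable_const.indicator hm).aemeasurable),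
    ← hS.map_typPos_obstDist, lintegral_indicator_const hm, one_mul,
    Measure.map_apply (hS.measurable_typPos.prodMk hS.measurable_obstDist) hm]
  rfl

/-- Activity splits off by independence. Given the position and the obstacles, absence of collision
is an orthant event for `txDist`, with probability a product of `censoredTail`s; this is then
averaged over the remaining variables. -/
lemma IsNetwork.measure_success [IsProbabilityMeasure P] (hS : IsNetwork P p S)
    (hlamT : 0 < p.lamT) (hlamO : 0 < p.lamO) (hc : 0 < p.thetaC) (htheta : 0 < p.theta)
    (hk : p.theta = numSectors p * p.thetaC) (hle : p.theta ≤ 2 * Real.pi) (hd : 0 < p.dmax) :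
    P {ω | (S ω).typActive = true ∧ ((S ω).typPos, obstDist p S ω) ∈ clearSet p ∧
        ∀ j, obstDist p S ω j ≤ txDist p S ω j} =
      ENNReal.ofReal p.rhoA * ENNReal.ofReal ((sectorArea p p.dmax)⁻¹ *
        ∫ s in (0 : ℝ)..sectorArea p p.dmax, clearProb p (lamI p) s) := by
  have := isProbabilityMeasure_censoredExp hlamO (sectorArea_nonneg hc p.dmax)
  have hm := measurableSet_clearSet p
  have hX : Measurable fun ω => ((S ω).typPos, obstDist p S ω) :=
    hS.measurable_typPos.prodMk hS.measurable_obstDist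
  have hmle : MeasurableSet {y : (ℂ × (Fin (numSectors p) → ℝ≥0∞)) × (Fin (numSectors p) → ℝ≥0∞) |
      y.1 ∈ clearSet p ∧ ∀ j, y.1.2 j ≤ y.2 j} := by
    have h : MeasurableSet {y : (ℂ × (Fin (numSectors p) → ℝ≥0∞)) ×
        (Fin (numSectors p) → ℝ≥0∞) | ∀ j, y.1.2 j ≤ y.2 j} := by
      rw [Set.ofPred_forall]
      exact .iInter fun j => measurableSet_le (by fun_prop) (by fun_prop)
    exact (measurable_fst hm).inter h
  have hi1 : IndepFun (fun ω => (S ω).typActive)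
      (fun ω => (((S ω).typPos, obstDist p S ω), txDist p S ω)) P := by
    refine hS.indepFun (T := {3}) (T' := {0, 1, 2}) (by simp)
      (measurable_of_partSigma rfl (measurable_typActive_partSigma S)) ?_
    exact Measurable.prodMk (Measurable.prodMk
      (measurable_of_partSigma (by simp) (measurable_typPos_partSigma S))
      (measurable_of_partSigma (by simp) (measurable_obstDist_partSigma p S)))
      (measurable_of_partSigma (by simp) (measurable_txDist_partSigma p S))
  have hi2 : IndepFun (fun ω => ((S ω).typPos, obstDist p S ω)) (txDist p S) P := by
    refine hS.indepFun (T := {1, 2}) (T' := {0}) (by simp) ?_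
      (measurable_of_partSigma rfl (measurable_txDist_partSigma p S))
    exact Measurable.prodMk
      (measurable_of_partSigma (by simp) (measurable_typPos_partSigma S))
      (measurable_of_partSigma (by simp) (measurable_obstDist_partSigma p S))
  refine (hi1.measure_inter_preimage_eq_mul {true} _ (measurableSet_singleton _) hmle).trans ?_
  rw [← Measure.map_apply hS.measurable_typActive (measurableSet_singleton _), hS.law_typActive,
    bernoulliMeasure_true,
    ← Measure.map_apply (hX.prodMk hS.measurable_txDist) hmle,
    (indepFun_iff_map_prod_eq_prod_map_map hX.aemeasurable hS.measurable_txDist.aemeasurable).1 hi2,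
    Measure.prod_apply hmle,
    ← lintegral_lintegral_clearSet hc hk htheta hle hd hlamO (lamI_nonneg hlamT.le htheta.le),
    ← hS.law_typPos, ← hS.map_obstDist hlamO hc hk hle hd]
  congr 1
  have h1 : ∀ x : ℂ × (Fin (numSectors p) → ℝ≥0∞), P.map (txDist p S) (Prod.mk x ⁻¹'
      {y | y.1 ∈ clearSet p ∧ ∀ j, y.1.2 j ≤ y.2 j}) = (clearSet p).indicator
        (fun x => ∏ i, censoredTail (lamI p) (sectorArea p p.dmax) (x.2 i)) x := by
    intro x
    by_cases hx : x ∈ clearSet p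
    · rw [Set.indicator_of_mem hx, ← hS.map_txDist hlamT htheta hc hk hle hd]
      congr 1
      ext v
      simp [hx]
    · rw [Set.indicator_of_notMem hx]
      simp [hx]
  simp_rw [h1]
  rw [hS.map_typPos_obstDist, lintegral_prod]
  refine (Measurable.indicator (Finset.measurable_prod _ fun i _ => ?_) hm).aemeasurable
  exact (measurable_censoredTail _ _).comp (by fun_prop)

end Network

/-! ### Matching the closed forms. -/

section ClosedForms

variable {p : Params}

lemma inv_mul_integral_clearProb_zero (hlamO : 0 < p.lamO) (hc : 0 < p.thetaC) (hd : 0 < p.dmax) :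
    (sectorArea p p.dmax)⁻¹ * ∫ s in (0 : ℝ)..sectorArea p p.dmax, clearProb p 0 s =
      (1 - Real.exp (-(p.lamO * sectorArea p p.dmax))) / (p.lamO * sectorArea p p.dmax) := by
  have hD0 : 0 < sectorArea p p.dmax := by unfold sectorArea; positivity
  have h1 : ∀ s, clearProb p 0 s = Real.exp (-(p.lamO * s)) := fun s => by
    simp [clearProb, hlamO.ne']
  simp_rw [h1]
  rw [intervalIntegral.integral_eq_sub_of_hasDerivAt
    (f := fun s => -(1 / p.lamO) * Real.exp (-(p.lamO * s)))]
  · simp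
    field_simp
    ring
  · intro s _
    have h := (((hasDerivAt_id s).const_mul p.lamO).neg.exp).const_mul (-(1 / p.lamO))
    refine h.congr_deriv ?_
    simp
    field_simp
  · exact Continuous.intervalIntegrable (by fun_prop) _ _

/-- `condCollisionProb` is conditional on line of sight of the typical link; multiplying by the
line-of-sight probability gives the joint probability `clearProb`. -/
lemma exp_mul_one_sub_condCollisionProb (hlamO : 0 < p.lamO) (hI : 0 ≤ lamI p) (l : ℝ) :
    Real.exp (-(p.lamO * sectorArea p l)) * (1 - condCollisionProb p l) =
      clearProb p (lamI p) (sectorArea p l) := by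
  have hne : p.lamO + lamI p ≠ 0 := by positivity
  unfold condCollisionProb clearProb
  rw [sub_sub_cancel, mul_left_comm]
  congr 1
  have e1 : Real.exp (-((p.lamO + lamI p) * sectorArea p l)) =
      Real.exp (-(p.lamO * sectorArea p l)) * Real.exp (-(lamI p * sectorArea p l)) := by
    rw [← Real.exp_add]; ring_nf
  have e2 : Real.exp (-(p.lamO * sectorArea p l)) * Real.exp (p.lamO * sectorArea p l) = 1 := by
    rw [← Real.exp_add]; simp
  rw [mul_sub, ← e1, ← mul_assoc, ← mul_div_assoc, mul_left_comm, e2]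
  field_simp
  ring

/-- Substituting `s = sectorArea p l`, the uniform density `ds / D` becomes `2 * l / dmax ^ 2 dl`.
-/
lemma integral_clearProb_sectorArea (hlamO : 0 < p.lamO) (hc : 0 < p.thetaC) (hd : 0 < p.dmax)
    (hI : 0 ≤ lamI p) :
    ∫ l in (0 : ℝ)..p.dmax,
        2 * (p.rhoA : ℝ) / p.dmax ^ 2 * Real.exp (-(p.lamO * sectorArea p l)) *
          (1 - condCollisionProb p l) * l =
      p.rhoA * ((sectorArea p p.dmax)⁻¹ *
        ∫ s in (0 : ℝ)..sectorArea p p.dmax, clearProb p (lamI p) s) := by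
  have hD0 : 0 < sectorArea p p.dmax := by unfold sectorArea; positivity
  have hderiv : ∀ l, HasDerivAt (sectorArea p) (p.thetaC * l) l := fun l => by
    have := ((hasDerivAt_pow 2 l).const_mul p.thetaC).div_const 2
    refine this.congr_deriv ?_
    simp; ring
  have h := intervalIntegral.integral_comp_mul_deriv (a := 0) (b := p.dmax)
    (f := sectorArea p) (f' := fun l => p.thetaC * l) (g := clearProb p (lamI p))
    (fun l _ => hderiv l) (by fun_prop) (continuous_clearProb p _)
  rw [show sectorArea p 0 = 0 by simp [sectorArea]] at h
  rw [← h, ← intervalIntegral.integral_const_mul, ← intervalIntegral.integral_const_mul]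
  refine intervalIntegral.integral_congr fun l _ => ?_
  simp only [Function.comp_apply]
  rw [mul_assoc (2 * (p.rhoA : ℝ) / p.dmax ^ 2), exp_mul_one_sub_condCollisionProb hlamO hI,
    show sectorArea p p.dmax = p.thetaC * p.dmax ^ 2 / 2 from rfl]
  field_simp

end ClosedForms

/-! ### Throughput and area spectral efficiency. -/

section Throughput

variable {Ω : Type*} {p : Params} {S : Ω → Snapshot}

lemma measurable_numOthers_partSigma (S : Ω → Snapshot) {R : Set ℂ} (hR : MeasurableSet R) :
    Measurable[partSigma S 0] fun ω => numOthers R (S ω) :=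
  (Measurable.of_discrete (f := ENat.toNat)).comp
    (measurable_encard_countSigma (fun ω => (S ω).tx) (hR.prod MeasurableSet.univ))

variable [MeasurableSpace Ω] {P : Measure Ω}

lemma IsNetwork.measurable_numOthers (hS : IsNetwork P p S) {R : Set ℂ} (hR : MeasurableSet R) :
    Measurable fun ω => numOthers R (S ω) :=
  (measurable_numOthers_partSigma S hR).mono (hS.partSigma_le 0) le_rfl

lemma IsNetwork.map_numOthers (hS : IsNetwork P p S) (hlamT : 0 < p.lamT) {R : Set ℂ}
    (hR : MeasurableSet R) {A : ℝ} (hRA : volume R = ENNReal.ofReal A) :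
    P.map (fun ω => numOthers R (S ω)) = poissonMeasure (p.lamT * A).toNNReal := by
  have hμ : ((ENNReal.ofReal p.lamT • (volume : Measure ℂ)).prod
      ((bernoulliMeasure true false p.rhoA).prod (AddCircle.haarAddCircle (T := 2 * Real.pi)))) (R ×ˢ Set.univ) =
      ENNReal.ofReal (p.lamT * A) := by
    rw [Measure.prod_prod, measure_univ, mul_one, Measure.smul_apply, smul_eq_mul, hRA,
      ENNReal.ofReal_mul hlamT.le]
  have h := hS.poisson_tx.map_toNat_count (hR.prod MeasurableSet.univ)
    (by rw [hμ]; exact ENNReal.ofReal_lt_top)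
  rw [hμ] at h
  exact h

lemma IsNetwork.integral_numOthers (hS : IsNetwork P p S) (hlamT : 0 < p.lamT) {R : Set ℂ}
    (hR : MeasurableSet R) {A : ℝ} (hRA : volume R = ENNReal.ofReal A) (f : ℕ → ℝ) :
    ∫ ω, f (numOthers R (S ω)) ∂P = ∫ n, f n ∂(poissonMeasure (p.lamT * A).toNNReal) := by
  rw [← hS.map_numOthers hlamT hR hRA, integral_map (hS.measurable_numOthers hR).aemeasurable
    Measurable.of_discrete.aestronglyMeasurable]

/-- Only slot `i` of the frame contributes. One null set serves all `n` and `i`, so the random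
`numOthers` may be inserted for `n`. -/
lemma IsNetwork.ae_tdma_eq (hS : IsNetwork P p S) (hc : 0 < p.thetaC)
    (hk : p.theta = numSectors p * p.thetaC) (hle : p.theta ≤ 2 * Real.pi) (hd : 0 < p.dmax) :
    ∀ᵐ ω ∂P, ∀ n i, i < n + 1 → tdma p n i (S ω) =
      (clearSet p).indicator 1 ((S ω).typPos, obstDist p S ω) * ((n : ℝ) + 1)⁻¹ := by
  classical
  filter_upwards [hS.ae_success_empty_iff hc hk hle hd] with ω hω n i hi
  unfold tdma
  rw [div_eq_mul_inv]
  congr 1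
  rw [Finset.sum_eq_single_of_mem i (Finset.mem_range.2 hi)]
  · simp [hω, Set.indicator_apply]
  · intro t _ hti
    simp [hω, hti]

variable [IsProbabilityMeasure P]

lemma IsNetwork.integral_clearSet (hS : IsNetwork P p S)
    (hlamO : 0 < p.lamO) (hc : 0 < p.thetaC) (htheta : 0 < p.theta)
    (hk : p.theta = numSectors p * p.thetaC) (hle : p.theta ≤ 2 * Real.pi) (hd : 0 < p.dmax) :
    ∫ ω, (clearSet p).indicator (1 : ℂ × (Fin (numSectors p) → ℝ≥0∞) → ℝ) ((S ω).typPos, obstDist p S ω) ∂P =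
      (1 - Real.exp (-(p.lamO * sectorArea p p.dmax))) / (p.lamO * sectorArea p p.dmax) := by
  have hm : MeasurableSet {ω | ((S ω).typPos, obstDist p S ω) ∈ clearSet p} :=
    (hS.measurable_typPos.prodMk hS.measurable_obstDist) (measurableSet_clearSet p)
  refine (integral_indicator_one hm).trans ?_
  rw [measureReal_def, hS.measure_clear hlamO hc htheta hk hle hd,
    inv_mul_integral_clearProb_zero hlamO hc hd, ENNReal.toReal_ofReal]
  have hD0 : 0 ≤ sectorArea p p.dmax := sectorArea_nonneg hc _
  have : Real.exp (-(p.lamO * sectorArea p p.dmax)) ≤ 1 :=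
    Real.exp_le_one_iff.2 (neg_nonpos.2 (by positivity))
  exact div_nonneg (by linarith) (by positivity)

lemma IsNetwork.integral_tdma (hS : IsNetwork P p S)
    (hlamO : 0 < p.lamO) (hc : 0 < p.thetaC) (htheta : 0 < p.theta)
    (hk : p.theta = numSectors p * p.thetaC) (hle : p.theta ≤ 2 * Real.pi) (hd : 0 < p.dmax)
    {n i : ℕ} (hi : i < n + 1) :
    ∫ ω, tdma p n i (S ω) ∂P =
      (1 - Real.exp (-(p.lamO * sectorArea p p.dmax))) / (p.lamO * sectorArea p p.dmax) *
        ((n : ℝ) + 1)⁻¹ := by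
  rw [integral_congr_ae ((hS.ae_tdma_eq hc hk hle hd).mono fun ω h => h n i hi),
    integral_mul_const, hS.integral_clearSet hlamO hc htheta hk hle hd]

lemma IsNetwork.integral_slottedAloha (hS : IsNetwork P p S)
    (hlamT : 0 < p.lamT) (hlamO : 0 < p.lamO) (hc : 0 < p.thetaC) (htheta : 0 < p.theta)
    (hk : p.theta = numSectors p * p.thetaC) (hle : p.theta ≤ 2 * Real.pi) (hd : 0 < p.dmax)
    (n i : ℕ) :
    ∫ ω, slottedAloha p n i (S ω) ∂P =
      ∫ l in (0 : ℝ)..p.dmax,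
        2 * (p.rhoA : ℝ) / p.dmax ^ 2 * Real.exp (-(p.lamO * sectorArea p l)) *
          (1 - condCollisionProb p l) * l := by
  classical
  have hI := lamI_nonneg hlamT.le htheta.le
  have hD0 : 0 ≤ sectorArea p p.dmax := sectorArea_nonneg hc _
  set E : Set Ω := {ω | (S ω).typActive = true ∧
    ((S ω).typPos, obstDist p S ω) ∈ clearSet p ∧
      ∀ j, obstDist p S ω j ≤ txDist p S ω j} with hE
  have hm : MeasurableSet E := by
    have h : MeasurableSet {ω | ∀ j, obstDist p S ω j ≤ txDist p S ω j} := by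
      rw [Set.ofPred_forall]
      exact .iInter fun j => measurableSet_le ((measurable_pi_apply j).comp hS.measurable_obstDist)
        ((measurable_pi_apply j).comp hS.measurable_txDist)
    exact (hS.measurable_typActive (measurableSet_singleton true)).inter
      (((hS.measurable_typPos.prodMk hS.measurable_obstDist) (measurableSet_clearSet p)).inter h)
  rw [integral_congr_ae (g := E.indicator 1), integral_indicator_one hm, measureReal_def,
    hS.measure_success hlamT hlamO hc htheta hk hle hd, integral_clearProb_sectorArea hlamO hc hd hI,
    ENNReal.toReal_mul, ENNReal.toReal_ofReal p.rhoA.2.1, ENNReal.toReal_ofReal]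
  · refine mul_nonneg (inv_nonneg.2 hD0) (intervalIntegral.integral_nonneg hD0 fun s hs => ?_)
    exact clearProb_nonneg hlamO hI hs.2
  · filter_upwards [hS.ae_success_iff hc hk hle hd] with ω hω
    simp only [slottedAloha, hω, Set.indicator_apply, hE, Set.mem_ofPred_eq, Pi.one_apply]

lemma IsNetwork.perLinkThroughput_tdma (hS : IsNetwork P p S)
    (hlamT : 0 < p.lamT) (hlamO : 0 < p.lamO) (hc : 0 < p.thetaC) (htheta : 0 < p.theta)
    (hk : p.theta = numSectors p * p.thetaC) (hle : p.theta ≤ 2 * Real.pi) (hd : 0 < p.dmax)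
    {R : Set ℂ} (hR : MeasurableSet R) {A : ℝ} (hA : 0 < A)
    (hRA : volume R = ENNReal.ofReal A) :
    perLinkThroughput P S R (tdma p) =
      ((1 - Real.exp (-(p.lamT * A))) / (p.lamT * A)) *
        ((1 - Real.exp (-(p.lamO * sectorArea p p.dmax))) / (p.lamO * sectorArea p p.dmax)) := by
  have hmean : 0 < p.lamT * A := by positivity
  have hm : Measurable ((clearSet p).indicator (1 : ℂ × (Fin (numSectors p) → ℝ≥0∞) → ℝ)) :=
    measurable_one.indicator (measurableSet_clearSet p)
  -- Line of sight depends on position and obstacles, the number of links only on the transmitter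
  -- process, so the expectation factorizes.
  have hind : IndepFun (fun ω => ((S ω).typPos, obstDist p S ω))
      (fun ω => numOthers R (S ω)) P := by
    refine hS.indepFun (T := {1, 2}) (T' := {0}) (by simp) ?_
      (measurable_of_partSigma rfl (measurable_numOthers_partSigma S hR))
    exact Measurable.prodMk
      (measurable_of_partSigma (by simp) (measurable_typPos_partSigma S))
      (measurable_of_partSigma (by simp) (measurable_obstDist_partSigma p S))
  have hcomp := hind.comp hm (Measurable.of_discrete (f := fun n : ℕ => ((n : ℝ) + 1)⁻¹))
  rw [perLinkThroughput, integral_congr_ae ((hS.ae_tdma_eq hc hk hle hd).mono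
    fun ω h => h (numOthers R (S ω)) 0 (Nat.succ_pos _))]
  refine (hcomp.integral_fun_mul_eq_mul_integral
    (hm.comp (hS.measurable_typPos.prodMk hS.measurable_obstDist)).aestronglyMeasurable
    (Measurable.of_discrete.comp (hS.measurable_numOthers hR)).aestronglyMeasurable).trans ?_
  simp only [Function.comp_apply]
  rw [hS.integral_clearSet hlamO hc htheta hk hle hd,
    hS.integral_numOthers hlamT hR hRA fun n => ((n : ℝ) + 1)⁻¹,
    integral_poissonMeasure_inv_add_one _ (by simpa using hmean), Real.coe_toNNReal _ hmean.le,
    mul_comm]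

lemma IsNetwork.areaSpectralEfficiency_tdma (hS : IsNetwork P p S)
    (hlamO : 0 < p.lamO) (hc : 0 < p.thetaC) (htheta : 0 < p.theta)
    (hk : p.theta = numSectors p * p.thetaC) (hle : p.theta ≤ 2 * Real.pi) (hd : 0 < p.dmax)
    {R : Set ℂ} {A : ℝ} (hA : 0 < A) (hRA : volume R = ENNReal.ofReal A) :
    areaSpectralEfficiency P S R (tdma p) =
      (1 - Real.exp (-(p.lamO * sectorArea p p.dmax))) / (A * p.lamO * sectorArea p p.dmax) := by
  set q := (1 - Real.exp (-(p.lamO * sectorArea p p.dmax))) / (p.lamO * sectorArea p p.dmax) with hq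
  -- Each of the `N + 1` links gets `q / (N + 1)`, so the sum is `q` whatever the value of `N`.
  have h1 : ∀ ω, ∑ i ∈ Finset.range (numOthers R (S ω) + 1),
      (∫ ω', tdma p (numOthers R (S ω)) i (S ω') ∂P) = q := by
    intro ω
    rw [Finset.sum_congr rfl fun i hi =>
      hS.integral_tdma hlamO hc htheta hk hle hd (Finset.mem_range.1 hi)]
    rw [Finset.sum_const, Finset.card_range, nsmul_eq_mul, ← hq]
    push_cast
    field_simp
  simp_rw [areaSpectralEfficiency, h1]
  rw [integral_const, hRA, ENNReal.toReal_ofReal hA.le, probReal_univ, one_smul, hq, div_div]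
  ring_nf

/-- The throughput of a link does not depend on `n` or `i`, so the sum is `N + 1` times it, and the
mean of `N + 1` is `1 + lamT * A`. -/
lemma IsNetwork.areaSpectralEfficiency_slottedAloha (hS : IsNetwork P p S)
    (hlamT : 0 < p.lamT) (hlamO : 0 < p.lamO) (hc : 0 < p.thetaC) (htheta : 0 < p.theta)
    (hk : p.theta = numSectors p * p.thetaC) (hle : p.theta ≤ 2 * Real.pi) (hd : 0 < p.dmax)
    {R : Set ℂ} (hR : MeasurableSet R) {A : ℝ} (hA : 0 < A)
    (hRA : volume R = ENNReal.ofReal A) :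
    areaSpectralEfficiency P S R (slottedAloha p) =
      (1 + A * p.lamT) / A *
        ∫ l in (0 : ℝ)..p.dmax,
          2 * (p.rhoA : ℝ) / p.dmax ^ 2 * Real.exp (-(p.lamO * sectorArea p l)) *
            (1 - condCollisionProb p l) * l := by
  have hmean : 0 < p.lamT * A := by positivity
  simp_rw [areaSpectralEfficiency, hS.integral_slottedAloha hlamT hlamO hc htheta hk hle hd,
    Finset.sum_const, Finset.card_range, nsmul_eq_mul]
  rw [integral_mul_const]
  push_cast
  rw [hS.integral_numOthers hlamT hR hRA fun n => (n : ℝ) + 1, integral_poissonMeasure_add_one,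
    Real.coe_toNNReal _ hmean.le, hRA, ENNReal.toReal_ofReal hA.le]
  ring

end Throughput

end MmWave

theorem proposition2 {Ω : Type*} [MeasurableSpace Ω] (P : MeasureTheory.Measure Ω)
    [MeasureTheory.IsProbabilityMeasure P] (p : MmWave.Params) (S : Ω → MmWave.Snapshot)
    (hlamT : 0 < p.lamT) (hlamO : 0 < p.lamO) (hthetaC : 0 < p.thetaC)
    (htheta : 0 < p.theta) (htheta_le : p.theta ≤ 2 * Real.pi) (hdmax : 0 < p.dmax)
    (hint : ∃ k : ℕ, p.theta = k * p.thetaC)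
    (hS : MmWave.IsNetwork P p S)
    (R : Set ℂ) (A : ℝ) (hR : MeasurableSet R) (hA : 0 < A)
    (hRA : MeasureTheory.volume R = ENNReal.ofReal A) :
    MmWave.perLinkThroughput P S R (MmWave.tdma p) =
        ((1 - Real.exp (-(p.lamT * A))) / (p.lamT * A)) *
          ((1 - Real.exp (-(p.lamO * MmWave.sectorArea p p.dmax))) /
            (p.lamO * MmWave.sectorArea p p.dmax)) ∧
      MmWave.areaSpectralEfficiency P S R (MmWave.tdma p) =
        (1 - Real.exp (-(p.lamO * MmWave.sectorArea p p.dmax))) /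
          (A * p.lamO * MmWave.sectorArea p p.dmax) ∧
      MmWave.areaSpectralEfficiency P S R (MmWave.slottedAloha p) =
        (1 + A * p.lamT) / A *
          ∫ l in (0 : ℝ)..p.dmax,
            2 * (p.rhoA : ℝ) / p.dmax ^ 2 * Real.exp (-(p.lamO * MmWave.sectorArea p l)) *
              (1 - MmWave.condCollisionProb p l) * l := by
  have hk := MmWave.theta_eq_numSectors hthetaC hint
  exact ⟨hS.perLinkThroughput_tdma hlamT hlamO hthetaC htheta hk htheta_le hdmax hR hA hRA,
    hS.areaSpectralEfficiency_tdma hlamO hthetaC htheta hk htheta_le hdmax hA hRA,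
    hS.areaSpectralEfficiency_slottedAloha hlamT hlamO hthetaC htheta hk htheta_le hdmax hR hA hRA⟩
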